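/- A symmetric triple $(\mathfrak g,\sigma,B)$ consists of a finite-dimensional real Lie algebra $\mathfrak g$, an involutive automorphism $\sigma$ of $\mathfrak g$ whose eigenspace decomposition $\mathfrak g=\mathfrak h\oplus\mathfrak m$ ($\sigma=+1$ on $\mathfrak h$, $\sigma=-1$ on $\mathfrak m$) satisfies $\mathfrak h=[\mathfrak m,\mathfrak m]$, and a non-degenerate symmetric bilinear form $B$ on $\mathfrak g$ invariant under $\sigma$ and under $\mathrm{ad}(\mathfrak g)$. It is indecomposable if $0$ and $\mathfrak m$ are the only $\mathrm{ad}(\mathfrak h)$-invariant subspaces of $\mathfrak m$ on which $B$ is non-degenerate. An isomorphism of symmetric triples is a Lie algebra isomorphism which intertwines the involutions and the bilinear forms. Let $n\ge 4$, $\epsilon_Y\in\{\pm1\}$, $r\in\{0,\dots,n-4\}$ and $\lambda=(\lambda_1,\lambda_2)$ with $\lambda_i\in\mathbb R^{n-4}$ and $(\lambda_1^\alpha,\lambda_2^\alpha)\neq(0,0)$ for all $\alpha$. Put $\epsilon_\alpha=-1$ for $\alpha\le r$ and $\epsilon_\alpha=+1$ for $\alpha>r$. The symmetric triple $\tau_n(\epsilon_Y,r,\lambda)=(\mathfrak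 h\oplus\mathfrak m,B)$ has the bases $\{y,W_1^*,\dots,W_{n-4}^*\}$ of $\mathfrak h$ and $\{Z_1,Z_2,W_1,\dots,W_{n-4},Z_1^*,Z_2^*\}$ of $\mathfrak m$; the products $B(y,y)=\epsilon_Y$, $B(W_\alpha^*,W_\alpha^*)=\epsilon_\alpha$, $B(W_\alpha,W_\alpha)=1$, $B(Z_i,Z_i^*)=1$, all other products of basis vectors being zero; and the brackets $$[Z_1^*,Z_2^*]=y,\quad [Z_i^*,W_\alpha]=\lambda_i^\alpha W_\alpha^*,\quad [y,Z_1^*]=\epsilon_Y Z_2,\quad [y,Z_2^*]=-\epsilon_Y Z_1,$$ $$[W_\alpha^*,Z_i^*]=\epsilon_\alpha\lambda_i^\alpha W_\alpha,\quad [W_\alpha^*,W_\beta]=-\delta_{\alpha\beta}\,\epsilon_\alpha(\lambda_1^\alpha Z_1+\lambda_2^\alpha Z_2),$$ all other brackets of basis vectors being zero up to skew-symmetry. For linearly independent $\lambda_1,\lambda_2$ put $$P_\lambda=\mathrm{span}\{\lambda_1,\lambda_2\},\qquad V_\lambda=\sum_{\alpha,\beta}(\lambda_1^\alpha\lambda_2^\beta-\lambda_2^\alpha\lambda_1^\beta)^2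 .$$ Let $\mathbb G_{2,n-4}$ be the set of two-dimensional subspaces of $\mathbb R^{n-4}$ and $e_\alpha^\perp=\{x\in\mathbb R^{n-4}: x^\alpha=0\}$. Let $\mathcal S_r\times\mathcal S_{n-r-4}$ (the permutations of the coordinates preserving $\{1,\dots,r\}$ and $\{r+1,\dots,n-4\}$) and $\{\pm1\}^{n-4}$ (sign changes of the coordinates) act on $\mathbb R^{n-4}$, hence on planes. Proposition. The assignment $\tau_n(\epsilon_Y,r,\lambda)\mapsto(\epsilon_Y,r,V_\lambda,[P_\lambda])$ induces a well-defined bijection from the set of isomorphism classes of indecomposable symmetric triples $\tau_n(\epsilon_Y,r,\lambda)$ with $\lambda_1,\lambda_2$ linearly independent onto the set of all $(\epsilon_Y,r,V,[P])$ with $\epsilon_Y\in\{\pm1\}$, $r\in\{0,\dots,n-4\}$, $V>0$ and $$[P]\in\Big\{P\in\mathbb G_{2,n-4} : P\not\subset\bigcup_\alpha e_\alpha^\perp\Big\}\Big/\big(\mathcal S_r\times\mathcal S_{n-r-4}\times\{\pm1\}^{n-4}\big).$$ Here $\lambda$ is determined by $V_\lambda$ and $P_\lambda$ in the following sense: for every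 such $P$ and every $V>0$, the pairs $\lambda=(\lambda_1,\lambda_2)$ with $P_\lambda=P$ and $V_\lambda=V$ form exactly one orbit (in particular a non-empty set) under $(\lambda_1,\lambda_2)\mapsto(\lambda_1,\lambda_2)S$, $S\in GL(2,\mathbb R)$, $\det S=\pm1$. In particular, if such a triple exists, then $n>5$. -/

import Mathlib

/-! ## Symmetric triples -/

/-- A symmetric triple `(𝔤, σ, B)`: a finite dimensional real Lie algebra `𝔤`, an involutive
automorphism `σ` with eigenspace decomposition `𝔤 = 𝔥 ⊕ 𝔪` (`𝔥 = {σ x = x}`, `𝔪 = {σ x = -x}`) such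
that `𝔥 = [𝔪, 𝔪]`, and a non-degenerate symmetric bilinear form `B` which is invariant under `σ`
and under `ad 𝔤`. -/
structure SymmetricTriple where
  carrier : Type
  [lieRing : LieRing carrier]
  [lieAlgebra : LieAlgebra ℝ carrier]
  [finiteDimensional : FiniteDimensional ℝ carrier]
  σ : carrier ≃ₗ⁅ℝ⁆ carrier
  σ_involutive : ∀ u, σ (σ u) = u
  B : LinearMap.BilinForm ℝ carrier
  B_symm : ∀ u v, B u v = B v u
  B_nondegenerate : B.Nondegenerate
  B_σ : ∀ u v, B (σ u) (σ v) = B u v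
  B_ad : ∀ a u v : carrier, B ⁅a, u⁆ v + B u ⁅a, v⁆ = 0
  bracket_span : (Submodule.span ℝ {a | ∃ u v : carrier, σ u = -u ∧ σ v = -v ∧ ⁅u, v⁆ = a} : Set carrier) =
    {a | σ a = a}

namespace SymmetricTriple

attribute [instance] lieRing lieAlgebra finiteDimensional

/-- The `(-1)`-eigenspace `𝔪` of `σ`. -/
def m (T : SymmetricTriple) : Submodule ℝ T.carrier where
  carrier := {u | T.σ u = -u}
  add_mem' := by
    intro a b ha hb
    simp only [Set.mem_ofPred_eq, map_add] at *
    rw [ha, hb, neg_add]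
  zero_mem' := by simp
  smul_mem' := by
    intro c a ha
    simp only [Set.mem_ofPred_eq, map_smul] at *
    rw [ha, smul_neg]

/-- A symmetric triple is indecomposable if the only subspaces of `𝔪` which are invariant under
`ad 𝔥` and on which `B` is non-degenerate are `0` and `𝔪`. -/
def Indecomposable (T : SymmetricTriple) : Prop :=
  ∀ V : Submodule ℝ T.carrier, V ≤ T.m →
    (∀ a, T.σ a = a → ∀ u ∈ V, ⁅a, u⁆ ∈ V) →
    (T.B.restrict V).Nondegenerate → V = ⊥ ∨ V = T.m

/-- Isomorphism of symmetric triples: a Lie algebra isomorphism which intertwines the involutions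
and the bilinear forms. -/
def Iso (T T' : SymmetricTriple) : Prop :=
  ∃ Φ : T.carrier ≃ₗ⁅ℝ⁆ T'.carrier,
    (∀ u, Φ (T.σ u) = T'.σ (Φ u)) ∧ ∀ u v, T.B u v = T'.B (Φ u) (Φ v)

theorem Iso.rfl (T : SymmetricTriple) : T.Iso T :=
  ⟨LieEquiv.refl, fun _ => by simp, fun _ _ => by simp⟩

theorem Iso.symm {T T' : SymmetricTriple} (h : T.Iso T') : T'.Iso T := by
  obtain ⟨Φ, h1, h2⟩ := h
  refine ⟨Φ.symm, fun u => ?_, fun u v => ?_⟩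
  · apply Φ.injective
    exact (Φ.apply_symm_apply _).trans
      (((h1 (Φ.symm u)).trans (congrArg T'.σ (Φ.apply_symm_apply u))).symm)
  · rw [h2, Φ.apply_symm_apply, Φ.apply_symm_apply]

theorem Iso.trans {T T' T'' : SymmetricTriple} (h : T.Iso T') (h' : T'.Iso T'') :
    T.Iso T'' := by
  obtain ⟨Φ, h1, h2⟩ := h
  obtain ⟨Ψ, h3, h4⟩ := h'
  refine ⟨Φ.trans Ψ, fun u => ?_, fun u v => ?_⟩
  · simp [h1, h3]
  · simp [h2, h4]

end SymmetricTriple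

/-! ## The normal form `τ_n(ε_Y, r, λ)`, with `s = n - 4` -/

/-- Parameters of the normal form: a sign `ε_Y`, a number `r ∈ {0, …, s}` and a pair
`λ₁, λ₂ ∈ ℝ^s` (here `lam 0`, `lam 1`) with `(λ₁^α, λ₂^α) ≠ 0` for all `α`. -/
structure TauParam (s : ℕ) where
  epsY : ℤˣ
  r : Fin (s + 1)
  lam : Fin 2 → Fin s → ℝ
  lam_ne : ∀ α, (lam 0 α, lam 1 α) ≠ (0, 0)

/-- The sign `ε_Y` as a real number. -/
def TauParam.eY {s : ℕ} (p : TauParam s) : ℝ := ((p.epsY : ℤ) : ℝ)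

/-- The signs `ε_α`: `-1` for the first `r` indices and `+1` for the others. -/
def TauParam.eps {s : ℕ} (p : TauParam s) (α : Fin s) : ℝ :=
  if (α : ℕ) < (p.r : ℕ) then -1 else 1

/-- The vector space `𝔥 ⊕ 𝔪` with basis `y, W_α^*, Z_i, W_α, Z_i^*`; the fields are the
coefficients with respect to these basis vectors. -/
@[ext]
structure TauSpace {s : ℕ} (p : TauParam s) where
  y : ℝ
  Ws : Fin s → ℝ
  Z : Fin 2 → ℝ
  W : Fin s → ℝ
  Zs : Fin 2 → ℝ

namespace TauSpace

variable {s : ℕ} {p : TauParam s}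

/-- The coefficients of a vector as a tuple. -/
def coeffs : TauSpace p ≃ ℝ × (Fin s → ℝ) × (Fin 2 → ℝ) × (Fin s → ℝ) × (Fin 2 → ℝ) where
  toFun u := (u.y, u.Ws, u.Z, u.W, u.Zs)
  invFun c := ⟨c.1, c.2.1, c.2.2.1, c.2.2.2.1, c.2.2.2.2⟩
  left_inv _ := rfl
  right_inv _ := rfl

/-- The coefficientwise addition. -/
instance instAddCommGroup : AddCommGroup (TauSpace p) := coeffs.addCommGroup

/-- The coefficientwise scalar multiplication. -/
instance instModule : Module ℝ (TauSpace p) := coeffs.module ℝ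

instance instFiniteDimensional : FiniteDimensional ℝ (TauSpace p) :=
  Module.Finite.equiv (coeffs.linearEquiv ℝ).symm

@[simp] theorem zero_y : (0 : TauSpace p).y = 0 := rfl
@[simp] theorem zero_Ws : (0 : TauSpace p).Ws = 0 := rfl
@[simp] theorem zero_Z : (0 : TauSpace p).Z = 0 := rfl
@[simp] theorem zero_W : (0 : TauSpace p).W = 0 := rfl
@[simp] theorem zero_Zs : (0 : TauSpace p).Zs = 0 := rfl
@[simp] theorem add_y (u v : TauSpace p) : (u + v).y = u.y + v.y := rfl
@[simp] theorem add_Ws (u v : TauSpace p) : (u + v).Ws = u.Ws + v.Ws := rfl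
@[simp] theorem add_Z (u v : TauSpace p) : (u + v).Z = u.Z + v.Z := rfl
@[simp] theorem add_W (u v : TauSpace p) : (u + v).W = u.W + v.W := rfl
@[simp] theorem add_Zs (u v : TauSpace p) : (u + v).Zs = u.Zs + v.Zs := rfl
@[simp] theorem neg_y (u : TauSpace p) : (-u).y = -u.y := rfl
@[simp] theorem neg_Ws (u : TauSpace p) : (-u).Ws = -u.Ws := rfl
@[simp] theorem neg_Z (u : TauSpace p) : (-u).Z = -u.Z := rfl
@[simp] theorem neg_W (u : TauSpace p) : (-u).W = -u.W := rfl
@[simp] theorem neg_Zs (u : TauSpace p) : (-u).Zs = -u.Zs := rfl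
@[simp] theorem smul_y (c : ℝ) (u : TauSpace p) : (c • u).y = c * u.y := rfl
@[simp] theorem smul_Ws (c : ℝ) (u : TauSpace p) : (c • u).Ws = c • u.Ws := rfl
@[simp] theorem smul_Z (c : ℝ) (u : TauSpace p) : (c • u).Z = c • u.Z := rfl
@[simp] theorem smul_W (c : ℝ) (u : TauSpace p) : (c • u).W = c • u.W := rfl
@[simp] theorem smul_Zs (c : ℝ) (u : TauSpace p) : (c • u).Zs = c • u.Zs := rfl

/-- The bilinear skew-symmetric bracket whose only non-zero values on basis vectors are, up to
skew-symmetry,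
`[Z₁^*, Z₂^*] = y`, `[Z_i^*, W_α] = λ_i^α W_α^*`, `[y, Z₁^*] = ε_Y Z₂`, `[y, Z₂^*] = -ε_Y Z₁`,
`[W_α^*, Z_i^*] = ε_α λ_i^α W_α` and `[W_α^*, W_β] = -δ_{αβ} ε_α (λ₁^α Z₁ + λ₂^α Z₂)`. -/
instance instBracket : Bracket (TauSpace p) (TauSpace p) where
  bracket u v :=
    { y := u.Zs 0 * v.Zs 1 - u.Zs 1 * v.Zs 0
      Ws := fun α => ∑ i, p.lam i α * (u.Zs i * v.W α - v.Zs i * u.W α)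
      Z := fun i =>
        ![-(p.eY * (u.y * v.Zs 1 - v.y * u.Zs 1)), p.eY * (u.y * v.Zs 0 - v.y * u.Zs 0)] i
          - ∑ α, p.eps α * p.lam i α * (u.Ws α * v.W α - v.Ws α * u.W α)
      W := fun α => ∑ i, p.eps α * p.lam i α * (u.Ws α * v.Zs i - v.Ws α * u.Zs i)
      Zs := 0 }

theorem bracket_y (u v : TauSpace p) : ⁅u, v⁆.y = u.Zs 0 * v.Zs 1 - u.Zs 1 * v.Zs 0 := rfl
theorem bracket_Ws (u v : TauSpace p) (α : Fin s) :
    ⁅u, v⁆.Ws α = p.lam 0 α * (u.Zs 0 * v.W α - v.Zs 0 * u.W α)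
      + p.lam 1 α * (u.Zs 1 * v.W α - v.Zs 1 * u.W α) := by
  rw [← Fin.sum_univ_two (f := fun i => p.lam i α * (u.Zs i * v.W α - v.Zs i * u.W α))]
  rfl
theorem bracket_Z_zero (u v : TauSpace p) :
    ⁅u, v⁆.Z 0 = -(p.eY * (u.y * v.Zs 1 - v.y * u.Zs 1))
      - ∑ α, p.eps α * p.lam 0 α * (u.Ws α * v.W α - v.Ws α * u.W α) := rfl
theorem bracket_Z_one (u v : TauSpace p) :
    ⁅u, v⁆.Z 1 = p.eY * (u.y * v.Zs 0 - v.y * u.Zs 0)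
      - ∑ α, p.eps α * p.lam 1 α * (u.Ws α * v.W α - v.Ws α * u.W α) := rfl
theorem bracket_W (u v : TauSpace p) (α : Fin s) :
    ⁅u, v⁆.W α = p.eps α * p.lam 0 α * (u.Ws α * v.Zs 0 - v.Ws α * u.Zs 0)
      + p.eps α * p.lam 1 α * (u.Ws α * v.Zs 1 - v.Ws α * u.Zs 1) := by
  rw [← Fin.sum_univ_two
    (f := fun i => p.eps α * p.lam i α * (u.Ws α * v.Zs i - v.Ws α * u.Zs i))]
  rfl
theorem bracket_Zs (u v : TauSpace p) : ⁅u, v⁆.Zs = 0 := rfl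

theorem ext_coeffs {u v : TauSpace p} (hy : u.y = v.y) (hWs : ∀ α, u.Ws α = v.Ws α)
    (hZ0 : u.Z 0 = v.Z 0) (hZ1 : u.Z 1 = v.Z 1) (hW : ∀ α, u.W α = v.W α)
    (hZs0 : u.Zs 0 = v.Zs 0) (hZs1 : u.Zs 1 = v.Zs 1) : u = v := by
  refine TauSpace.ext hy (funext hWs) (funext fun i => ?_) (funext hW) (funext fun i => ?_)
  · fin_cases i
    · exact hZ0
    · exact hZ1
  · fin_cases i
    · exact hZs0
    · exact hZs1

theorem add_bracket (u v w : TauSpace p) : ⁅u + v, w⁆ = ⁅u, w⁆ + ⁅v, w⁆ := by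
  apply ext_coeffs
  · simp only [bracket_y, add_y, add_Zs, Pi.add_apply]; ring
  · intro α; simp only [bracket_Ws, add_Ws, add_W, add_Zs, Pi.add_apply]; ring
  · simp only [bracket_Z_zero, add_y, add_Ws, add_W, add_Zs, add_Z, Pi.add_apply]
    have : ∀ f g h : Fin s → ℝ, (∀ α, h α = f α + g α) → ∑ α, h α = ∑ α, f α + ∑ α, g α := by
      intro f g h H; rw [← Finset.sum_add_distrib]; exact Finset.sum_congr rfl fun α _ => H α
    rw [this (fun α => p.eps α * p.lam 0 α * (u.Ws α * w.W α - w.Ws α * u.W α))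
      (fun α => p.eps α * p.lam 0 α * (v.Ws α * w.W α - w.Ws α * v.W α)) _ (fun α => by ring)]
    ring
  · simp only [bracket_Z_one, add_y, add_Ws, add_W, add_Zs, add_Z, Pi.add_apply]
    have : ∀ f g h : Fin s → ℝ, (∀ α, h α = f α + g α) → ∑ α, h α = ∑ α, f α + ∑ α, g α := by
      intro f g h H; rw [← Finset.sum_add_distrib]; exact Finset.sum_congr rfl fun α _ => H α
    rw [this (fun α => p.eps α * p.lam 1 α * (u.Ws α * w.W α - w.Ws α * u.W α))
      (fun α => p.eps α * p.lam 1 α * (v.Ws α * w.W α - w.Ws α * v.W α)) _ (fun α => by ring)]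
    ring
  · intro α; simp only [bracket_W, add_Ws, add_W, add_Zs, Pi.add_apply]; ring
  · simp [bracket_Zs]
  · simp [bracket_Zs]

theorem bracket_skew (u v : TauSpace p) : ⁅u, v⁆ = -⁅v, u⁆ := by
  apply ext_coeffs
  · simp only [bracket_y, neg_y]; ring
  · intro α; simp only [bracket_Ws, neg_Ws, Pi.neg_apply]; ring
  · simp only [bracket_Z_zero, neg_Z, Pi.neg_apply, neg_sub, sub_neg_eq_add]
    rw [sub_eq_add_neg, ← Finset.sum_neg_distrib, add_comm]
    congr 1
    · exact Finset.sum_congr rfl fun α _ => by ring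
    · ring
  · simp only [bracket_Z_one, neg_Z, Pi.neg_apply, neg_sub]
    rw [sub_eq_add_neg, sub_eq_add_neg, ← Finset.sum_neg_distrib, add_comm]
    congr 1
    · exact Finset.sum_congr rfl fun α _ => by ring
    · ring
  · intro α; simp only [bracket_W, neg_W, Pi.neg_apply]; ring
  · simp [bracket_Zs]
  · simp [bracket_Zs]

theorem smul_bracket (c : ℝ) (u v : TauSpace p) : ⁅c • u, v⁆ = c • ⁅u, v⁆ := by
  apply ext_coeffs
  · simp only [bracket_y, smul_y, smul_Zs, Pi.smul_apply, smul_eq_mul]; ring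
  · intro α; simp only [bracket_Ws, smul_Ws, smul_W, smul_Zs, Pi.smul_apply, smul_eq_mul]; ring
  · simp only [bracket_Z_zero, smul_y, smul_Ws, smul_W, smul_Zs, smul_Z, Pi.smul_apply, smul_eq_mul]
    rw [mul_sub c, Finset.mul_sum]
    congr 1
    · ring
    · exact Finset.sum_congr rfl fun α _ => by ring
  · simp only [bracket_Z_one, smul_y, smul_Ws, smul_W, smul_Zs, smul_Z, Pi.smul_apply, smul_eq_mul]
    rw [mul_sub c, Finset.mul_sum]
    congr 1
    · ring
    · exact Finset.sum_congr rfl fun α _ => by ring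
  · intro α; simp only [bracket_W, smul_Ws, smul_W, smul_Zs, Pi.smul_apply, smul_eq_mul]; ring
  · simp [bracket_Zs]
  · simp [bracket_Zs]

theorem jacobi_sum (u v w : TauSpace p) (i : Fin 2) :
    ∑ α, p.eps α * p.lam i α * (u.Ws α * ⁅v, w⁆.W α - ⁅v, w⁆.Ws α * u.W α) =
      ∑ α, p.eps α * p.lam i α * (⁅u, v⁆.Ws α * w.W α - w.Ws α * ⁅u, v⁆.W α)
      + ∑ α, p.eps α * p.lam i α * (v.Ws α * ⁅u, w⁆.W α - ⁅u, w⁆.Ws α * v.W α) := by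
  rw [← Finset.sum_add_distrib]
  refine Finset.sum_congr rfl fun α _ => ?_
  simp only [bracket_W, bracket_Ws]
  ring

theorem leibniz (u v w : TauSpace p) : ⁅u, ⁅v, w⁆⁆ = ⁅⁅u, v⁆, w⁆ + ⁅v, ⁅u, w⁆⁆ := by
  apply ext_coeffs
  · simp only [bracket_y u, bracket_y v ⁅u, w⁆, bracket_y ⁅u, v⁆, add_y, bracket_Zs, Pi.zero_apply]
    ring
  · intro α
    simp only [bracket_Ws u ⁅v, w⁆, bracket_Ws v ⁅u, w⁆, bracket_Ws ⁅u, v⁆, add_Ws, bracket_Zs,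
      Pi.zero_apply, Pi.add_apply, bracket_W]
    ring
  · have := jacobi_sum u v w 0
    simp only [bracket_Z_zero, add_Z, Pi.add_apply, bracket_Zs, Pi.zero_apply, bracket_y]
    linear_combination -this
  · have := jacobi_sum u v w 1
    simp only [bracket_Z_one, add_Z, Pi.add_apply, bracket_Zs, Pi.zero_apply, bracket_y]
    linear_combination -this
  · intro α
    simp only [bracket_W u ⁅v, w⁆, bracket_W v ⁅u, w⁆, bracket_W ⁅u, v⁆, add_W, bracket_Zs,
      Pi.zero_apply, Pi.add_apply, bracket_Ws]
    ring
  · simp [bracket_Zs]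
  · simp [bracket_Zs]

instance instLieRing : LieRing (TauSpace p) where
  add_lie := add_bracket
  lie_add u v w := by
    rw [bracket_skew, add_bracket, neg_add, ← bracket_skew, ← bracket_skew]
  lie_self u := by
    apply ext_coeffs
    · simp only [bracket_y, zero_y]; ring
    · intro α; simp [bracket_Ws]
    · simp [bracket_Z_zero]
    · simp [bracket_Z_one]
    · intro α; simp [bracket_W]
    · simp [bracket_Zs]
    · simp [bracket_Zs]
  leibniz_lie := leibniz

instance instLieAlgebra : LieAlgebra ℝ (TauSpace p) where
  lie_smul c u v := by
    rw [bracket_skew, smul_bracket, ← smul_neg, ← bracket_skew]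

/-- The involution: `+1` on `𝔥 = span {y, W_α^*}` and `-1` on `𝔪 = span {Z_i, W_α, Z_i^*}`. -/
def flip (u : TauSpace p) : TauSpace p := ⟨u.y, u.Ws, -u.Z, -u.W, -u.Zs⟩

theorem flip_flip (u : TauSpace p) : flip (flip u) = u := by
  simp [flip]

theorem flip_lie (u v : TauSpace p) : flip ⁅u, v⁆ = ⁅flip u, flip v⁆ := by
  apply ext_coeffs
  · simp only [flip, bracket_y, Pi.neg_apply]; ring
  · intro α; simp only [flip, bracket_Ws, Pi.neg_apply]; ring
  · have : ∑ α, p.eps α * p.lam 0 α * (u.Ws α * -v.W α - v.Ws α * -u.W α) =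
        -∑ α, p.eps α * p.lam 0 α * (u.Ws α * v.W α - v.Ws α * u.W α) := by
      rw [← Finset.sum_neg_distrib]
      exact Finset.sum_congr rfl fun α _ => by ring
    simp only [flip, bracket_Z_zero, Pi.neg_apply, this]
    ring
  · have : ∑ α, p.eps α * p.lam 1 α * (u.Ws α * -v.W α - v.Ws α * -u.W α) =
        -∑ α, p.eps α * p.lam 1 α * (u.Ws α * v.W α - v.Ws α * u.W α) := by
      rw [← Finset.sum_neg_distrib]
      exact Finset.sum_congr rfl fun α _ => by ring
    simp only [flip, bracket_Z_one, Pi.neg_apply, this]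
    ring
  · intro α; simp only [flip, bracket_W, Pi.neg_apply]; ring
  · simp [flip, bracket_Zs]
  · simp [flip, bracket_Zs]

/-- The involution as a Lie algebra automorphism. -/
def sigma : TauSpace p ≃ₗ⁅ℝ⁆ TauSpace p where
  toFun := flip
  invFun := flip
  left_inv := flip_flip
  right_inv := flip_flip
  map_add' u v := by
    apply ext_coeffs <;> simp [flip, add_comm]
  map_smul' c u := by
    apply ext_coeffs <;> simp [flip]
  map_lie' := flip_lie _ _

/-- The metric: `B(y,y) = ε_Y`, `B(W_α^*,W_β^*) = ε_α δ_{αβ}`, `B(Z_i,Z_j^*) = δ_{ij}`,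
`B(W_α,W_β) = δ_{αβ}`, and all other products of basis vectors vanish. -/
def form : LinearMap.BilinForm ℝ (TauSpace p) :=
  LinearMap.mk₂ ℝ
    (fun u v => p.eY * (u.y * v.y) + ∑ α, p.eps α * (u.Ws α * v.Ws α)
      + ∑ i, (u.Z i * v.Zs i + u.Zs i * v.Z i) + ∑ α, u.W α * v.W α)
    (by
      intro u v w
      simp only [add_y, add_Ws, add_Z, add_W, add_Zs, Pi.add_apply, add_mul, mul_add,
        Finset.sum_add_distrib]
      ring)
    (by
      intro c u v
      simp only [smul_y, smul_Ws, smul_Z, smul_W, smul_Zs, Pi.smul_apply, smul_eq_mul, mul_add,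
        Finset.mul_sum, Finset.sum_add_distrib]
      simp only [mul_assoc, mul_left_comm c])
    (by
      intro u v w
      simp only [add_y, add_Ws, add_Z, add_W, add_Zs, Pi.add_apply, mul_add,
        Finset.sum_add_distrib]
      ring)
    (by
      intro c u v
      simp only [smul_y, smul_Ws, smul_Z, smul_W, smul_Zs, Pi.smul_apply, smul_eq_mul, mul_add,
        Finset.mul_sum, Finset.sum_add_distrib]
      simp only [mul_left_comm _ c])

theorem sigma_apply (u : TauSpace p) : sigma u = flip u := rfl

theorem form_apply (u v : TauSpace p) :
    form u v = p.eY * (u.y * v.y) + ∑ α, p.eps α * (u.Ws α * v.Ws α)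
      + ∑ i, (u.Z i * v.Zs i + u.Zs i * v.Z i) + ∑ α, u.W α * v.W α := rfl

theorem form_symm (u v : TauSpace p) : form u v = form v u := by
  simp only [form_apply, mul_comm, add_comm]

theorem eY_ne_zero : p.eY ≠ 0 := by
  rcases Int.units_eq_one_or p.epsY with h | h <;> simp [TauParam.eY, h]

theorem eps_ne_zero (α : Fin s) : p.eps α ≠ 0 := by
  unfold TauParam.eps; split_ifs <;> norm_num

theorem eq_zero_of_form (u : TauSpace p) (h : ∀ v, form u v = 0) : u = 0 := by
  apply ext_coeffs
  · have := h ⟨1, 0, 0, 0, 0⟩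
    simpa [form_apply, eY_ne_zero] using this
  · intro α
    have := h ⟨0, Pi.single α 1, 0, 0, 0⟩
    simpa [form_apply, eps_ne_zero, Pi.single_apply] using this
  · have := h ⟨0, 0, 0, 0, Pi.single 0 1⟩
    simpa [form_apply] using this
  · have := h ⟨0, 0, 0, 0, Pi.single 1 1⟩
    simpa [form_apply] using this
  · intro α
    have := h ⟨0, 0, 0, Pi.single α 1, 0⟩
    simpa [form_apply, Pi.single_apply] using this
  · have := h ⟨0, 0, Pi.single 0 1, 0, 0⟩
    simpa [form_apply] using this
  · have := h ⟨0, 0, Pi.single 1 1, 0, 0⟩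
    simpa [form_apply] using this

theorem form_nondegenerate : (form (p := p)).Nondegenerate := by
  refine ⟨fun u h => eq_zero_of_form u h, fun u h => eq_zero_of_form u fun v => ?_⟩
  rw [form_symm]; exact h v

theorem form_flip (u v : TauSpace p) : form (flip u) (flip v) = form u v := by
  simp [form_apply, flip]

theorem form_ad (a u v : TauSpace p) : form ⁅a, u⁆ v + form u ⁅a, v⁆ = 0 := by
  simp only [form_apply, Fin.sum_univ_two, bracket_y, bracket_Z_zero, bracket_Z_one, bracket_Zs,
    Pi.zero_apply, mul_zero, zero_mul, add_zero, zero_add, sub_mul, mul_sub, Finset.sum_mul,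
    Finset.mul_sum]
  have key : ∑ α, p.eps α * (⁅a, u⁆.Ws α * v.Ws α) + ∑ α, ⁅a, u⁆.W α * v.W α
      + ∑ α, p.eps α * (u.Ws α * ⁅a, v⁆.Ws α) + ∑ α, u.W α * ⁅a, v⁆.W α
      - ∑ α, p.eps α * p.lam 0 α * (a.Ws α * u.W α - u.Ws α * a.W α) * v.Zs 0
      - ∑ α, p.eps α * p.lam 1 α * (a.Ws α * u.W α - u.Ws α * a.W α) * v.Zs 1
      - ∑ α, u.Zs 0 * (p.eps α * p.lam 0 α * (a.Ws α * v.W α - v.Ws α * a.W α))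
      - ∑ α, u.Zs 1 * (p.eps α * p.lam 1 α * (a.Ws α * v.W α - v.Ws α * a.W α)) = 0 := by
    simp only [← Finset.sum_add_distrib, ← Finset.sum_sub_distrib]
    refine Finset.sum_eq_zero fun α _ => ?_
    simp only [bracket_W, bracket_Ws]
    ring
  simp only [sub_mul, mul_sub] at key
  linear_combination key

theorem flip_eq_self {a : TauSpace p} (h : flip a = a) : a.Z = 0 ∧ a.W = 0 ∧ a.Zs = 0 :=
  ⟨neg_eq_self.mp (congrArg TauSpace.Z h), neg_eq_self.mp (congrArg TauSpace.W h),
    neg_eq_self.mp (congrArg TauSpace.Zs h)⟩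

theorem span_bracket :
    (Submodule.span ℝ {a : TauSpace p | ∃ u v : TauSpace p, sigma u = -u ∧ sigma v = -v ∧ ⁅u, v⁆ = a} :
      Set (TauSpace p)) = {a | sigma a = a} := by
  apply Set.Subset.antisymm
  · intro a ha
    refine Submodule.span_induction ?_ ?_ ?_ ?_ (SetLike.mem_coe.mp ha)
    · rintro _ ⟨u, v, hu, hv, rfl⟩
      simp only [Set.mem_ofPred_eq, LieEquiv.map_lie, hu, hv, neg_lie, lie_neg, neg_neg]
    · simp
    · intro u v _ _ hu hv
      simp only [Set.mem_ofPred_eq, map_add] at *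
      rw [hu, hv]
    · intro c u _ hu
      simp only [Set.mem_ofPred_eq, map_smul] at *
      rw [hu]
  · intro a ha
    obtain ⟨hZ, hW, hZs⟩ := flip_eq_self (show flip a = a from ha)
    have hy : (⟨1, 0, 0, 0, 0⟩ : TauSpace p) ∈
        Submodule.span ℝ {a : TauSpace p | ∃ u v : TauSpace p, sigma u = -u ∧ sigma v = -v ∧ ⁅u, v⁆ = a} := by
      apply Submodule.subset_span
      refine ⟨⟨0, 0, 0, 0, Pi.single 0 1⟩, ⟨0, 0, 0, 0, Pi.single 1 1⟩, ?_, ?_, ?_⟩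
      · apply ext_coeffs <;> simp [sigma_apply, flip]
      · apply ext_coeffs <;> simp [sigma_apply, flip]
      · apply ext_coeffs <;>
          simp [bracket_y, bracket_Ws, bracket_Z_zero, bracket_Z_one, bracket_W, bracket_Zs]
    have hX : ∀ i α, p.lam i α • (⟨0, Pi.single α 1, 0, 0, 0⟩ : TauSpace p) ∈
        Submodule.span ℝ {a : TauSpace p | ∃ u v : TauSpace p, sigma u = -u ∧ sigma v = -v ∧ ⁅u, v⁆ = a} := by
      intro i α
      apply Submodule.subset_span
      refine ⟨⟨0, 0, 0, 0, Pi.single i 1⟩, ⟨0, 0, 0, Pi.single α 1, 0⟩, ?_, ?_, ?_⟩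
      · apply ext_coeffs <;> simp [sigma_apply, flip]
      · apply ext_coeffs <;> simp [sigma_apply, flip]
      · have hs : ∀ β, p.lam i β = p.lam i α ∨ (Pi.single α 1 : Fin s → ℝ) β = 0 := by
          intro β
          by_cases h : β = α
          · exact Or.inl (by rw [h])
          · exact Or.inr (Pi.single_eq_of_ne h 1)
        fin_cases i <;> apply ext_coeffs <;>
          simp [bracket_y, bracket_Ws, bracket_Z_zero, bracket_Z_one, bracket_W, bracket_Zs] <;>
          exact hs
    have hWs : ∀ α, (⟨0, Pi.single α 1, 0, 0, 0⟩ : TauSpace p) ∈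
        Submodule.span ℝ {a : TauSpace p | ∃ u v : TauSpace p, sigma u = -u ∧ sigma v = -v ∧ ⁅u, v⁆ = a} := by
      intro α
      have hne := p.lam_ne α
      by_cases h0 : p.lam 0 α = 0
      · have h1 : p.lam 1 α ≠ 0 := fun h1 => hne (by rw [h0, h1])
        exact (Submodule.smul_mem_iff _ h1).mp (hX 1 α)
      · exact (Submodule.smul_mem_iff _ h0).mp (hX 0 α)
    have hsum : ∀ (f : Fin s → TauSpace p) (t : Finset (Fin s)), (∑ α ∈ t, f α).y = ∑ α ∈ t, (f α).y ∧
        (∑ α ∈ t, f α).Ws = ∑ α ∈ t, (f α).Ws ∧ (∑ α ∈ t, f α).Z = ∑ α ∈ t, (f α).Z ∧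
        (∑ α ∈ t, f α).W = ∑ α ∈ t, (f α).W ∧ (∑ α ∈ t, f α).Zs = ∑ α ∈ t, (f α).Zs := by
      intro f t
      induction t using Finset.induction_on with
      | empty => simp
      | insert b t hb ih => simp [Finset.sum_insert hb, ih]
    have ha' : a = a.y • (⟨1, 0, 0, 0, 0⟩ : TauSpace p)
        + ∑ α, a.Ws α • (⟨0, Pi.single α 1, 0, 0, 0⟩ : TauSpace p) := by
      obtain ⟨h1, h2, h3, h4, h5⟩ :=
        hsum (fun α => a.Ws α • (⟨0, Pi.single α 1, 0, 0, 0⟩ : TauSpace p)) Finset.univ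
      apply ext_coeffs <;>
        simp [h1, h2, h3, h4, h5, hZ, hW, hZs, Finset.sum_apply, Pi.single_apply]
    rw [SetLike.mem_coe, ha']
    exact Submodule.add_mem _ (Submodule.smul_mem _ _ hy)
      (Submodule.sum_mem _ fun α _ => Submodule.smul_mem _ _ (hWs α))

end TauSpace

/-- The symmetric triple `τ_n(ε_Y, r, λ)`, `n = s + 4`. -/
def tau {s : ℕ} (p : TauParam s) : SymmetricTriple where
  carrier := TauSpace p
  σ := TauSpace.sigma
  σ_involutive := TauSpace.flip_flip
  B := TauSpace.form
  B_symm := TauSpace.form_symm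
  B_nondegenerate := TauSpace.form_nondegenerate
  B_σ := TauSpace.form_flip
  B_ad := TauSpace.form_ad
  bracket_span := TauSpace.span_bracket

/-! ## Isomorphism classes -/

/-- The indecomposable symmetric triples which are of the form `τ_n(ε_Y, r, λ)` (up to isomorphism)
with `λ₁, λ₂` of rank two. -/
def IndecTauRankTwo (s : ℕ) : Type 1 :=
  {T : SymmetricTriple // T.Indecomposable ∧
    ∃ p : TauParam s, LinearIndependent ℝ p.lam ∧ T.Iso (tau p)}

/-- Isomorphism as an equivalence relation on these triples. -/
instance isoSetoid (s : ℕ) : Setoid (IndecTauRankTwo s) where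
  r T T' := T.1.Iso T'.1
  iseqv := ⟨fun T => .rfl T.1, fun h => h.symm, fun h h' => h.trans h'⟩

/-- The set of isomorphism classes. -/
def IsoClasses (s : ℕ) : Type 1 := Quotient (isoSetoid s)

/-- The isomorphism class of `τ_n(ε_Y, r, λ)`. -/
def isoClass {s : ℕ} (p : TauParam s) (hp : LinearIndependent ℝ p.lam)
    (hi : (tau p).Indecomposable) : IsoClasses s :=
  Quotient.mk (isoSetoid s) ⟨tau p, hi, p, hp, .rfl _⟩

/-! ## The invariants -/

/-- `P_λ`, the span of `λ₁, λ₂`. -/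
def spanPlane {s : ℕ} (lam : Fin 2 → Fin s → ℝ) : Submodule ℝ (Fin s → ℝ) :=
  Submodule.span ℝ {lam 0, lam 1}

/-- `V_λ = ∑_{α,β} (λ₁^α λ₂^β - λ₂^α λ₁^β)²`. -/
def planeVolume {s : ℕ} (lam : Fin 2 → Fin s → ℝ) : ℝ :=
  ∑ α, ∑ β, (lam 0 α * lam 1 β - lam 1 α * lam 0 β) ^ 2

/-- The planes `P ∈ 𝔾_{2,s}` which are not contained in the union of the coordinate hyperplanes
`e_α^⊥`. -/
def Plane (s : ℕ) : Type :=
  {P : Submodule ℝ (Fin s → ℝ) // Module.finrank ℝ P = 2 ∧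
    ¬ (P : Set (Fin s → ℝ)) ⊆ ⋃ α, {x | x α = 0}}

/-- The linear action of a permutation and of signs on `ℝ^s`: `e_α ↦ θ_{π α} e_{π α}`. -/
def signedPerm {s : ℕ} (π : Equiv.Perm (Fin s)) (θ : Fin s → ℤˣ) :
    (Fin s → ℝ) →ₗ[ℝ] (Fin s → ℝ) where
  toFun x := fun α => ((θ α : ℤ) : ℝ) * x (π.symm α)
  map_add' x y := by ext α; simp [mul_add]
  map_smul' c x := by ext α; simp [mul_left_comm]

theorem signedPerm_comp {s : ℕ} (π π' : Equiv.Perm (Fin s)) (θ θ' : Fin s → ℤˣ) :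
    (signedPerm π' θ').comp (signedPerm π θ) =
      signedPerm (π.trans π') (fun α => θ' α * θ (π'.symm α)) := by
  ext x α
  simp [signedPerm, mul_assoc]

theorem signedPerm_refl {s : ℕ} : signedPerm (Equiv.refl (Fin s)) (fun _ => 1) = LinearMap.id := by
  ext x α
  simp [signedPerm]

/-- The orbit relation of `𝒮_r × 𝒮_{s-r} × {±1}^s` on the planes; `𝒮_r × 𝒮_{s-r}` consists of the
permutations which respect the partition into the first `r` and the last `s - r` indices. -/
def planeSetoid (s : ℕ) (r : Fin (s + 1)) : Setoid (Plane s) where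
  r P Q := ∃ (π : Equiv.Perm (Fin s)) (θ : Fin s → ℤˣ),
    (∀ α, (π α : ℕ) < (r : ℕ) ↔ (α : ℕ) < (r : ℕ)) ∧ Q.1 = P.1.map (signedPerm π θ)
  iseqv := by
    refine ⟨fun P => ⟨Equiv.refl _, fun _ => 1, fun _ => Iff.rfl, ?_⟩, ?_, ?_⟩
    · rw [signedPerm_refl, Submodule.map_id]
    · rintro P Q ⟨π, θ, hπ, h⟩
      refine ⟨π.symm, fun α => θ (π α), fun α => ?_, ?_⟩
      · rw [← hπ, Equiv.apply_symm_apply]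
      · rw [h, ← Submodule.map_comp, signedPerm_comp]
        have : signedPerm (π.trans π.symm) (fun α => θ (π α) * θ (π.symm.symm α)) =
            LinearMap.id := by
          rw [← signedPerm_refl]
          congr 1
          · ext α; simp
          · funext α; simp
        rw [this, Submodule.map_id]
    · rintro P Q R ⟨π, θ, hπ, h⟩ ⟨π', θ', hπ', h'⟩
      refine ⟨π.trans π', fun α => θ' α * θ (π'.symm α), fun α => ?_, ?_⟩
      · rw [Equiv.trans_apply, hπ', hπ]
      · rw [h', h, ← Submodule.map_comp, signedPerm_comp]

/-- The set of data `(ε_Y, r, V, [P])`. -/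
abbrev Invariants (s : ℕ) : Type :=
  ℤˣ × (Σ r : Fin (s + 1), Set.Ioi (0 : ℝ) × Quotient (planeSetoid s r))

/-!
The normal form is determined by its invariants for an elementary reason. Let `Φ` be an isomorphism
`τ(ε_Y, r, λ) → τ(ε_Y', r', λ')`. It maps each `W_α` to a vector without `Z^*`-coefficients
(`TauSpace.map_basisW_Zs`), and therefore induces an isometry `U` between the positive definite
spans of the `W_α` and a matrix `M` between the spans of the `Z_i^*`. For given `z, w`, the map
`x ↦ [[z, x], w]` acts on the `W_α`, modulo the `Z_i`, by the diagonal matrix with entries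
`ε_α λ^α(z) λ^α(w)`, where `λ^α(z) = ∑ i, λ_i^α z_i`, and `U` intertwines these diagonal matrices
for `τ` and `τ'`. An entry `U_{βα} ≠ 0` thus forces equality of the corresponding diagonal entries,
and the Leibniz formula for `det U ≠ 0` provides a permutation `π` with `U_{π(α) α} ≠ 0` for all
`α`. Hence `ε_α = ε'_{π(α)}`, and the linear forms `λ^α` and `λ'^{π(α)} ∘ M` agree up to sign. Since
`Φ` maps `y = [Z_1^*, Z_2^*]` to `(det M) y` (`TauSpace.map_basisY_Ws`), comparing `B(y, y)` yields
`ε_Y = ε_Y'` and `det M = ±1`. This is `exists_of_iso`; conversely such `π`, signs and `M` define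
an isomorphism (`TauSpace.iso_of_transport`).

A basis of a plane is determined up to matrices of determinant `±1` by its volume
(`volume_and_span_eq_iff`), so the existence of `π`, signs and `M` says precisely that the
invariants agree (`iso_tau_iff_invariants_eq`). Every tuple of invariants occurs, since a plane has
bases of every positive volume and the planes contained in no coordinate hyperplane are those
with `(λ_1^α, λ_2^α) ≠ 0` for all `α` (`not_spanPlane_subset_iff`), and since every `τ` is indecomposable
(`indecomposable_tau`). Finally, linear independence of `λ_1, λ_2` in `ℝ^{n-4}` requires `n ≥ 6`.
-/

/-! ### Planes, volumes and changes of basis -/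

section Planes

variable {s : ℕ}

theorem planeVolume_matrix_comb (lam : Fin 2 → Fin s → ℝ) (S : Matrix (Fin 2) (Fin 2) ℝ) :
    planeVolume (fun i => ∑ j, S j i • lam j) = S.det ^ 2 * planeVolume lam := by
  simp only [planeVolume, Finset.mul_sum]
  refine Finset.sum_congr rfl fun α _ => Finset.sum_congr rfl fun β _ => ?_
  simp only [Fin.sum_univ_two, Matrix.det_fin_two, Pi.add_apply, Pi.smul_apply, smul_eq_mul]
  ring

theorem planeVolume_pos {lam : Fin 2 → Fin s → ℝ} (h : LinearIndependent ℝ lam) :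
    0 < planeVolume lam := by
  have hnn : ∀ α β, 0 ≤ (lam 0 α * lam 1 β - lam 1 α * lam 0 β) ^ 2 := fun _ _ => sq_nonneg _
  refine lt_of_le_of_ne (Finset.sum_nonneg fun α _ => Finset.sum_nonneg fun β _ => hnn α β) ?_
  intro h0
  have hminor : ∀ α β, lam 0 α * lam 1 β - lam 1 α * lam 0 β = 0 := by
    intro α β
    have h1 := (Finset.sum_eq_zero_iff_of_nonneg
      (fun α _ => Finset.sum_nonneg fun β _ => hnn α β)).mp h0.symm α (Finset.mem_univ α)
    have h2 := (Finset.sum_eq_zero_iff_of_nonneg (fun β _ => hnn α β)).mp h1 β (Finset.mem_univ β)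
    exact pow_eq_zero_iff two_ne_zero |>.mp h2
  obtain ⟨α, hα⟩ := Function.ne_iff.mp (h.ne_zero 0)
  have hcomb : ∑ j, ![-lam 1 α, lam 0 α] j • lam j = 0 := by
    ext β
    simp only [Fin.sum_univ_two, Pi.add_apply, Pi.smul_apply, smul_eq_mul, Matrix.cons_val_zero,
      Matrix.cons_val_one, Pi.zero_apply]
    linear_combination hminor α β
  exact hα (Fintype.linearIndependent_iff.mp h _ hcomb 1)

theorem range_fin_two {β : Type*} (f : Fin 2 → β) : Set.range f = {f 0, f 1} := by
  ext x
  simp [Fin.exists_fin_two, eq_comm]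

theorem linearIndependent_iff_finrank_spanPlane {lam : Fin 2 → Fin s → ℝ} :
    LinearIndependent ℝ lam ↔ Module.finrank ℝ (spanPlane lam) = 2 := by
  rw [linearIndependent_iff_card_eq_finrank_span, Set.finrank, range_fin_two, Fintype.card_fin,
    spanPlane, eq_comm]

theorem mem_spanPlane {lam : Fin 2 → Fin s → ℝ} {x : Fin s → ℝ} :
    x ∈ spanPlane lam ↔ ∃ a b : ℝ, a • lam 0 + b • lam 1 = x :=
  Submodule.mem_span_pair

theorem lam_mem_spanPlane (lam : Fin 2 → Fin s → ℝ) (i : Fin 2) : lam i ∈ spanPlane lam := by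
  apply Submodule.subset_span
  rw [← range_fin_two]
  exact Set.mem_range_self i

theorem spanPlane_le_iff {lam : Fin 2 → Fin s → ℝ} {P : Submodule ℝ (Fin s → ℝ)} :
    spanPlane lam ≤ P ↔ ∀ i, lam i ∈ P := by
  rw [spanPlane, Submodule.span_le, ← range_fin_two, Set.range_subset_iff]
  rfl

/-- The bases of a plane with the same volume as a given basis are those obtained from it by a
matrix of determinant `±1`, because the volume is multiplied by the square of the determinant. -/
theorem volume_and_span_eq_iff {lam lam' : Fin 2 → Fin s → ℝ} (h : LinearIndependent ℝ lam) :
    (planeVolume lam' = planeVolume lam ∧ spanPlane lam' = spanPlane lam) ↔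
      ∃ S : Matrix (Fin 2) (Fin 2) ℝ, |S.det| = 1 ∧ ∀ i, lam' i = ∑ j, S j i • lam j := by
  constructor
  · rintro ⟨hV, hP⟩
    have hmem : ∀ i, lam' i ∈ spanPlane lam := fun i => hP ▸ lam_mem_spanPlane lam' i
    choose a b hab using fun i => mem_spanPlane.mp (hmem i)
    have hS : ∀ i, lam' i = ∑ j, (Matrix.of ![a, b]) j i • lam j := by
      intro i
      simp [Fin.sum_univ_two, hab]
    refine ⟨Matrix.of ![a, b], ?_, hS⟩
    have hdet := planeVolume_matrix_comb lam (Matrix.of ![a, b])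
    rw [← funext hS, hV] at hdet
    have : (Matrix.of ![a, b]).det ^ 2 = 1 :=
      mul_right_cancel₀ (planeVolume_pos h).ne' (hdet.symm.trans (one_mul _).symm)
    rw [← abs_one (α := ℝ), ← sq_eq_sq_iff_abs_eq_abs, one_pow, this]
  · rintro ⟨S, hdet, hS⟩
    have hd2 : S.det ^ 2 = 1 := by rw [← sq_abs, hdet, one_pow]
    obtain rfl := funext hS
    have hV : planeVolume (fun i => ∑ j, S j i • lam j) = planeVolume lam := by
      rw [planeVolume_matrix_comb, hd2, one_mul]
    refine ⟨hV, le_antisymm (spanPlane_le_iff.mpr fun i =>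
      Submodule.sum_mem _ fun j _ => Submodule.smul_mem _ _ (lam_mem_spanPlane lam j))
      (spanPlane_le_iff.mpr ?_)⟩
    -- `lam` is recovered by the adjugate matrix divided by the determinant
    have hinv : ∀ k, lam k = ∑ i, (S.det * S.adjugate i k) • ∑ j, S j i • lam j := by
      intro k
      rw [Matrix.det_fin_two] at hd2 ⊢
      ext α
      fin_cases k <;>
      · simp [Fin.sum_univ_two, Matrix.adjugate_fin_two]
        linear_combination (-lam _ α) * hd2
    intro k
    rw [hinv k]
    exact Submodule.sum_mem _ fun i _ =>
      Submodule.smul_mem _ _ (lam_mem_spanPlane (fun i => ∑ j, S j i • lam j) i)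

/-- Every plane has a basis of any prescribed positive volume. -/
theorem exists_basis_of_volume {P : Submodule ℝ (Fin s → ℝ)} (hP : Module.finrank ℝ P = 2)
    {V : ℝ} (hV : 0 < V) :
    ∃ lam : Fin 2 → Fin s → ℝ, planeVolume lam = V ∧ spanPlane lam = P := by
  let b : Module.Basis (Fin 2) ℝ P := Module.finBasisOfFinrankEq ℝ P hP
  let mu : Fin 2 → Fin s → ℝ := fun i => (b i : Fin s → ℝ)
  have hmu : LinearIndependent ℝ mu := b.linearIndependent.map' P.subtype P.ker_subtype
  have hpos := planeVolume_pos hmu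
  let c : ℝ := √(V / planeVolume mu)
  have hc : 0 < c := Real.sqrt_pos.mpr (div_pos hV hpos)
  let S : Matrix (Fin 2) (Fin 2) ℝ := Matrix.diagonal ![c, 1]
  have hvol : planeVolume (fun i => ∑ j, S j i • mu j) = V := by
    rw [planeVolume_matrix_comb]
    simp only [S, Matrix.det_diagonal, Fin.prod_univ_two, Matrix.cons_val_zero,
      Matrix.cons_val_one, mul_one, c]
    rw [Real.sq_sqrt (div_pos hV hpos).le, div_mul_cancel₀ _ hpos.ne']
  have hlam : (fun i => ∑ j, S j i • mu j) = ![c • mu 0, mu 1] := by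
    ext i α
    fin_cases i <;> simp [S, Fin.sum_univ_two, Matrix.diagonal_apply]
  rw [hlam] at hvol
  refine ⟨![c • mu 0, mu 1], hvol, ?_⟩
  have hli : LinearIndependent ℝ ![c • mu 0, mu 1] := by
    have := hmu.units_smul ![Units.mk0 c hc.ne', 1]
    convert this using 1
    ext i α
    fin_cases i <;> simp
  refine Submodule.eq_of_le_of_finrank_eq (spanPlane_le_iff.mpr fun i => ?_)
    ((linearIndependent_iff_finrank_spanPlane.mp hli).trans hP.symm)
  fin_cases i
  · exact P.smul_mem c (b 0).2
  · exact (b 1).2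

/-- A finite union of coordinate hyperplanes covers `P_λ` only if one of them contains it, since
`λ₁ + t λ₂` leaves all of them for all but finitely many `t`. -/
theorem not_spanPlane_subset_iff {lam : Fin 2 → Fin s → ℝ} :
    ¬ (spanPlane lam : Set (Fin s → ℝ)) ⊆ ⋃ α, {x | x α = 0} ↔
      ∀ α, (lam 0 α, lam 1 α) ≠ (0, 0) := by
  simp only [Set.not_subset, Set.mem_iUnion, Set.mem_ofPred_eq, not_exists, ne_eq, Prod.mk.injEq]
  constructor
  · rintro ⟨x, hx, hne⟩ α ⟨h0, h1⟩
    obtain ⟨a, b, rfl⟩ := mem_spanPlane.mp hx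
    exact hne α (by simp [h0, h1])
  · intro h
    obtain ⟨t, ht⟩ := Infinite.exists_notMem_finset
      (Finset.univ.image fun α => -lam 0 α / lam 1 α)
    refine ⟨lam 0 + t • lam 1, mem_spanPlane.mpr ⟨1, t, by simp⟩, fun α hα => ?_⟩
    simp only [Pi.add_apply, Pi.smul_apply, smul_eq_mul] at hα
    by_cases h1 : lam 1 α = 0
    · exact h α ⟨by simpa [h1] using hα, h1⟩
    · refine ht (Finset.mem_image.mpr ⟨α, Finset.mem_univ α, ?_⟩)
      rw [div_eq_iff h1]
      linarith

theorem unit_cast_mul_self (u : ℤˣ) : ((u : ℤ) : ℝ) * ((u : ℤ) : ℝ) = 1 := by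
  rcases Int.units_eq_one_or u with h | h <;> simp [h]

theorem planeVolume_signedPerm (π : Equiv.Perm (Fin s)) (θ : Fin s → ℤˣ)
    (lam : Fin 2 → Fin s → ℝ) :
    planeVolume (fun i => signedPerm π θ (lam i)) = planeVolume lam := by
  simp only [planeVolume]
  rw [← Equiv.sum_comp π]
  refine Finset.sum_congr rfl fun α _ => ?_
  rw [← Equiv.sum_comp π]
  refine Finset.sum_congr rfl fun β _ => ?_
  simp only [signedPerm, LinearMap.coe_mk, AddHom.coe_mk, Equiv.symm_apply_apply]
  have hα := unit_cast_mul_self (θ (π α))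
  have hβ := unit_cast_mul_self (θ (π β))
  linear_combination (lam 0 α * lam 1 β - lam 1 α * lam 0 β) ^ 2 * hα * 
      ((θ (π β) : ℤ) : ℝ) ^ 2 + (lam 0 α * lam 1 β - lam 1 α * lam 0 β) ^ 2 * hβ

theorem spanPlane_signedPerm (π : Equiv.Perm (Fin s)) (θ : Fin s → ℤˣ)
    (lam : Fin 2 → Fin s → ℝ) :
    spanPlane (fun i => signedPerm π θ (lam i)) = (spanPlane lam).map (signedPerm π θ) := by
  rw [spanPlane, spanPlane, Submodule.map_span, Set.image_pair]

theorem card_filter_val_lt (r : Fin (s + 1)) :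
    (Finset.univ.filter fun α : Fin s => (α : ℕ) < (r : ℕ)).card = r := by
  rw [Fin.card_filter_val_lt]
  exact min_eq_right (Nat.lt_succ_iff.mp r.2)

theorem eps_perm_iff (p p' : TauParam s) (π : Equiv.Perm (Fin s)) :
    (∀ α, p'.eps (π α) = p.eps α) ↔
      p.r = p'.r ∧ ∀ α, (π α : ℕ) < (p.r : ℕ) ↔ (α : ℕ) < (p.r : ℕ) := by
  have key : (∀ α, p'.eps (π α) = p.eps α) ↔
      ∀ α, (π α : ℕ) < (p'.r : ℕ) ↔ (α : ℕ) < (p.r : ℕ) := by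
    refine forall_congr' fun α => ?_
    simp only [TauParam.eps]
    split_ifs with h1 h2 h2 <;> norm_num [h1, h2]
  rw [key]
  constructor
  · intro h
    have hr : p.r = p'.r := by
      ext
      rw [← card_filter_val_lt p.r, ← card_filter_val_lt p'.r]
      refine Finset.card_equiv π fun α => ?_
      simp [h]
    exact ⟨hr, hr ▸ h⟩
  · rintro ⟨hr, h⟩
    exact hr ▸ h

end Planes

/-! ### Indecomposability -/

namespace TauSpace

variable {s : ℕ} {p : TauParam s}

theorem eq_neg_flip {u : TauSpace p} (h : flip u = -u) : u.y = 0 ∧ u.Ws = 0 :=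
  ⟨self_eq_neg.mp (congrArg TauSpace.y h), self_eq_neg.mp (congrArg TauSpace.Ws h)⟩

/-- The basis vector `y`. -/
def basisY : TauSpace p := ⟨1, 0, 0, 0, 0⟩

/-- The basis vector `W_α^*`. -/
def basisWs (α : Fin s) : TauSpace p := ⟨0, Pi.single α 1, 0, 0, 0⟩

/-- The basis vector `W_α`. -/
def basisW (α : Fin s) : TauSpace p := ⟨0, 0, 0, Pi.single α 1, 0⟩

/-- The basis vector `Z_i^*`. -/
def basisZs (i : Fin 2) : TauSpace p := ⟨0, 0, 0, 0, Pi.single i 1⟩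

theorem lie_basisY (u : TauSpace p) :
    ⁅(basisY : TauSpace p), u⁆ = ⟨0, 0, ![-(p.eY * u.Zs 1), p.eY * u.Zs 0], 0, 0⟩ := by
  apply ext_coeffs <;>
    simp [basisY, bracket_y, bracket_Ws, bracket_Z_zero, bracket_Z_one, bracket_W, bracket_Zs]

theorem lie_basisWs (α : Fin s) (u : TauSpace p) :
    ⁅(basisWs α : TauSpace p), u⁆ = ⟨0, 0, fun i => -(p.eps α * p.lam i α * u.W α),
      Pi.single α (p.eps α * (p.lam 0 α * u.Zs 0 + p.lam 1 α * u.Zs 1)), 0⟩ := by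
  apply ext_coeffs
  · simp [basisWs, bracket_y]
  · simp [basisWs, bracket_Ws]
  · simp [basisWs, bracket_Z_zero, Pi.single_apply]
  · simp [basisWs, bracket_Z_one, Pi.single_apply]
  · intro β
    rcases eq_or_ne β α with rfl | h
    · simp [basisWs, bracket_W]; ring
    · simp [basisWs, bracket_W, Pi.single_eq_of_ne h]
  · simp [bracket_Zs]
  · simp [bracket_Zs]

theorem flip_basisY : flip (basisY : TauSpace p) = basisY := by simp [flip, basisY]

theorem flip_basisWs (α : Fin s) : flip (basisWs α : TauSpace p) = basisWs α := by
  simp [flip, basisWs]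

theorem flip_basisW (α : Fin s) : flip (basisW α : TauSpace p) = -basisW α := by
  apply ext_coeffs <;> simp [flip, basisW]

/-- A non-zero vector of a subspace on which the form is non-degenerate has a partner there. -/
theorem exists_form_ne_zero {V : Submodule ℝ (TauSpace p)}
    (hV : (form.restrict V).Nondegenerate) {u : TauSpace p} (hu : u ∈ V) (h0 : u ≠ 0) :
    ∃ v ∈ V, form u v ≠ 0 := by
  by_contra! h
  exact h0 (congrArg Subtype.val (hV.1 ⟨u, hu⟩ fun v => h v.1 v.2))

end TauSpace

open TauSpace in
/-- Let `V ⊆ 𝔪` be invariant and non-degenerate. If all `Z^*`-coefficients vanish on `V`, then the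
`Z`-vectors of `V` lie in its radical, and `W_α^*` maps every vector of `V` to such a vector, so
`V = 0`. Otherwise `y` maps a vector of `V` with non-zero `Z^*`-coefficients `a` to a non-zero
`Z`-vector, whose partner has `Z^*`-coefficients independent of `a`; applying `y` and `W_α^*` to
both yields all `Z_i` and `W_α`. -/
theorem indecomposable_tau {s : ℕ} (p : TauParam s) : (tau p).Indecomposable := by
  intro (V : Submodule ℝ (TauSpace p)) hVm hinv (hV : (form.restrict V).Nondegenerate)
  have hm : ∀ u ∈ V, u.y = 0 ∧ u.Ws = 0 := fun u hu => eq_neg_flip (hVm hu)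
  have hY : ∀ u ∈ V, ⁅(basisY : TauSpace p), u⁆ ∈ V := hinv basisY flip_basisY
  have hWs : ∀ α, ∀ u ∈ V, ⁅(basisWs α : TauSpace p), u⁆ ∈ V :=
    fun α => hinv (basisWs α) (flip_basisWs α)
  have heps := eps_ne_zero (p := p)
  have heY := eY_ne_zero (p := p)
  by_cases hZs : ∀ u ∈ V, u.Zs = 0
  · left
    have hZ : ∀ u ∈ V, u.W = 0 → u = 0 := by
      intro u hu hW
      by_contra h0
      obtain ⟨v, hv, hne⟩ := exists_form_ne_zero hV hu h0
      refine hne ?_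
      simp [form_apply, hm u hu, hW, hZs u hu, hZs v hv]
    refine (Submodule.eq_bot_iff V).mpr fun u hu => hZ u hu (funext fun α => ?_)
    have hz := hZ _ (hWs α u hu) (by simp [lie_basisWs, hZs u hu])
    rw [lie_basisWs] at hz
    by_contra hα
    have h (i : Fin 2) : p.lam i α = 0 := by
      have := congrFun (congrArg TauSpace.Z hz) i
      have hα' : u.W α ≠ 0 := hα
      simpa [heps α, hα'] using this
    exact p.lam_ne α (by rw [h 0, h 1])
  · right
    push Not at hZs
    obtain ⟨u, hu, hu0⟩ := hZs
    have hyu : ⁅(basisY : TauSpace p), u⁆ ≠ 0 := by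
      intro h
      rw [lie_basisY] at h
      have h1 : u.Zs 1 = 0 := by simpa [heY] using congrFun (congrArg TauSpace.Z h) 0
      have h0 : u.Zs 0 = 0 := by simpa [heY] using congrFun (congrArg TauSpace.Z h) 1
      exact hu0 (funext fun i => by fin_cases i <;> assumption)
    obtain ⟨v, hv, huv⟩ := exists_form_ne_zero hV (hY u hu) hyu
    have hd : u.Zs 0 * v.Zs 1 - u.Zs 1 * v.Zs 0 ≠ 0 := by
      intro h
      refine huv ?_
      simp only [form_apply, lie_basisY, Fin.sum_univ_two]
      simp
      linear_combination p.eY * h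
    set d := u.Zs 0 * v.Zs 1 - u.Zs 1 * v.Zs 0 with hddef
    -- Cramer's rule: every value of the `Z^*`-coefficients is attained on `span {u, v}`
    have hsurj : ∀ z : Fin 2 → ℝ, ∃ w ∈ V, w.Zs = z := by
      intro z
      refine ⟨((z 0 * v.Zs 1 - z 1 * v.Zs 0) / d) • u + ((u.Zs 0 * z 1 - u.Zs 1 * z 0) / d) • v,
        V.add_mem (V.smul_mem _ hu) (V.smul_mem _ hv), funext fun i => ?_⟩
      fin_cases i <;>
      · simp
        field_simp
        rw [hddef]
        ring
    have hZmem : ∀ z : Fin 2 → ℝ, (⟨0, 0, z, 0, 0⟩ : TauSpace p) ∈ V := by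
      intro z
      obtain ⟨w, hw, hwz⟩ := hsurj ![z 1 / p.eY, -(z 0) / p.eY]
      convert hY w hw using 1
      rw [lie_basisY, hwz]
      apply ext_coeffs <;> simp <;> field_simp
    have hWmem : ∀ α, (basisW α : TauSpace p) ∈ V := by
      intro α
      obtain ⟨w, hw, hwz⟩ := hsurj ![p.lam 0 α, p.lam 1 α]
      have hq : p.lam 0 α * p.lam 0 α + p.lam 1 α * p.lam 1 α ≠ 0 := by
        intro h
        obtain ⟨h0, h1⟩ := mul_self_add_mul_self_eq_zero.mp h
        exact p.lam_ne α (by rw [h0, h1])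
      have hmem := V.sub_mem (hWs α w hw)
        (hZmem fun i => -(p.eps α * p.lam i α * w.W α))
      have heq : ⁅(basisWs α : TauSpace p), w⁆ - ⟨0, 0, fun i => -(p.eps α * p.lam i α * w.W α), 0, 0⟩
          = (p.eps α * (p.lam 0 α * p.lam 0 α + p.lam 1 α * p.lam 1 α)) • basisW α := by
        rw [lie_basisWs, hwz, sub_eq_add_neg]
        apply ext_coeffs
        · simp [basisW]
        · simp [basisW]
        · simp [basisW]
        · simp [basisW]
        · intro β
          rcases eq_or_ne β α with rfl | h
          · simp [basisW]
          · simp [basisW, Pi.single_eq_of_ne h]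
        · simp [basisW]
        · simp [basisW]
      rw [heq] at hmem
      exact (V.smul_mem_iff (mul_ne_zero (heps α) hq)).mp hmem
    refine le_antisymm hVm fun (x : TauSpace p) hx => ?_
    obtain ⟨hxy, hxWs⟩ := eq_neg_flip (u := x) hx
    obtain ⟨w, hw, hwx⟩ := hsurj x.Zs
    have hWsum : ∀ t : Fin s → ℝ, (⟨0, 0, 0, t, 0⟩ : TauSpace p) ∈ V := by
      intro t
      let incl : (Fin s → ℝ) →ₗ[ℝ] TauSpace p :=
        { toFun := fun t => ⟨0, 0, 0, t, 0⟩
          map_add' := fun a b => by apply ext_coeffs <;> simp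
          map_smul' := fun c a => by apply ext_coeffs <;> simp }
      change incl t ∈ V
      rw [← Finset.univ_sum_single t, map_sum]
      refine V.sum_mem fun α _ => ?_
      have : (Pi.single α (t α) : Fin s → ℝ) = t α • Pi.single α 1 := by
        rw [← Pi.single_smul, smul_eq_mul, mul_one]
      rw [this, map_smul]
      exact V.smul_mem _ (hWmem α)
    have hdecomp : x = w + ⟨0, 0, x.Z - w.Z, 0, 0⟩ + ⟨0, 0, 0, x.W - w.W, 0⟩ := by
      obtain ⟨hwy, hwWs⟩ := hm w hw
      apply ext_coeffs <;> simp [hxy, hxWs, hwy, hwWs, hwx]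
    rw [hdecomp]
    exact V.add_mem (V.add_mem hw (hZmem _)) (hWsum _)

/-! ### Isomorphisms given by signed permutations -/

namespace TauSpace

variable {s : ℕ} {p p' : TauParam s}

theorem finrank_eq : Module.finrank ℝ (TauSpace p) = Module.finrank ℝ (TauSpace p') :=
  ((coeffs.linearEquiv ℝ).trans (coeffs.linearEquiv ℝ).symm).finrank_eq

/-- The linear map `Z_j^* ↦ ∑ i, M_ij Z_i^*`, `Z ↦ (Mᵀ)⁻¹ Z`, `y ↦ (det M) y`,
`W_α ↦ θ_{π α} W_{π α}`, `W_α^* ↦ W_{π α}^*`. The inverse transpose of `M` is written out for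
`det M = ±1`, where it is `det M` times the cofactor matrix. -/
def transport (π : Equiv.Perm (Fin s)) (θ : Fin s → ℤˣ) (M : Matrix (Fin 2) (Fin 2) ℝ) :
    TauSpace p →ₗ[ℝ] TauSpace p' where
  toFun u :=
    { y := M.det * u.y
      Ws := fun α => u.Ws (π.symm α)
      Z := ![M.det * (M 1 1 * u.Z 0 - M 1 0 * u.Z 1), M.det * (M 0 0 * u.Z 1 - M 0 1 * u.Z 0)]
      W := signedPerm π θ u.W
      Zs := fun i => M i 0 * u.Zs 0 + M i 1 * u.Zs 1 }
  map_add' u v := by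
    apply ext_coeffs
    · simp; ring
    · simp
    · simp; ring
    · simp; ring
    · simp
    · simp; ring
    · simp; ring
  map_smul' c u := by
    apply ext_coeffs
    · simp; ring
    · simp
    · simp; ring
    · simp; ring
    · simp
    · simp; ring
    · simp; ring

section transport

variable (π : Equiv.Perm (Fin s)) (θ : Fin s → ℤˣ) (M : Matrix (Fin 2) (Fin 2) ℝ)

theorem transport_y (u : TauSpace p) :
    (transport π θ M u : TauSpace p').y = M.det * u.y := rfl
theorem transport_Ws (u : TauSpace p) (α : Fin s) :
    (transport π θ M u : TauSpace p').Ws (π α) = u.Ws α := by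
  change u.Ws (π.symm (π α)) = _
  rw [Equiv.symm_apply_apply]
theorem transport_Z_zero (u : TauSpace p) : (transport π θ M u : TauSpace p').Z 0 =
    M.det * (M 1 1 * u.Z 0 - M 1 0 * u.Z 1) := rfl
theorem transport_Z_one (u : TauSpace p) : (transport π θ M u : TauSpace p').Z 1 =
    M.det * (M 0 0 * u.Z 1 - M 0 1 * u.Z 0) := rfl
theorem transport_W (u : TauSpace p) (α : Fin s) :
    (transport π θ M u : TauSpace p').W (π α) = ((θ (π α) : ℤ) : ℝ) * u.W α := by
  change ((θ (π α) : ℤ) : ℝ) * u.W (π.symm (π α)) = _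
  rw [Equiv.symm_apply_apply]
theorem transport_Zs (u : TauSpace p) (i : Fin 2) :
    (transport π θ M u : TauSpace p').Zs i = M i 0 * u.Zs 0 + M i 1 * u.Zs 1 := rfl

theorem transport_flip (u : TauSpace p) :
    (transport π θ M (flip u) : TauSpace p') = flip (transport π θ M u) := by
  apply ext_coeffs
  · rfl
  · intro α; rfl
  · simp only [transport_Z_zero, flip, Pi.neg_apply]; ring
  · simp only [transport_Z_one, flip, Pi.neg_apply]; ring
  · intro α
    obtain ⟨α, rfl⟩ := π.surjective α
    simp only [transport_W, flip, Pi.neg_apply]; ring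
  · simp only [transport_Zs, flip, Pi.neg_apply]; ring
  · simp only [transport_Zs, flip, Pi.neg_apply]; ring

variable {π θ M} (hd : M.det ^ 2 = 1) (heY : p'.eY = p.eY)
  (heps : ∀ α, p'.eps (π α) = p.eps α)
  (hlam : ∀ j α, ((θ (π α) : ℤ) : ℝ) * p.lam j α =
    M 0 j * p'.lam 0 (π α) + M 1 j * p'.lam 1 (π α))

include hd heY heps in
theorem transport_form (u v : TauSpace p) :
    form (transport π θ M u : TauSpace p') (transport π θ M v) = form u v := by
  have h1 : ∑ α, p'.eps α * ((transport π θ M u : TauSpace p').Ws α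
      * (transport π θ M v : TauSpace p').Ws α) = ∑ α, p.eps α * (u.Ws α * v.Ws α) := by
    rw [← Equiv.sum_comp π]
    exact Finset.sum_congr rfl fun α _ => by rw [transport_Ws, transport_Ws, heps]
  have h2 : ∑ α, (transport π θ M u : TauSpace p').W α * (transport π θ M v : TauSpace p').W α
      = ∑ α, u.W α * v.W α := by
    rw [← Equiv.sum_comp π]
    refine Finset.sum_congr rfl fun α _ => ?_
    rw [transport_W, transport_W]
    linear_combination u.W α * v.W α * unit_cast_mul_self (θ (π α))
  rw [form_apply, form_apply, h1, h2, heY]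
  simp only [Fin.sum_univ_two, transport_y, transport_Z_zero, transport_Z_one, transport_Zs]
  rw [Matrix.det_fin_two] at *
  linear_combination (p.eY * (u.y * v.y) + u.Z 0 * v.Zs 0 + u.Zs 0 * v.Z 0
    + u.Z 1 * v.Zs 1 + u.Zs 1 * v.Z 1) * hd

include hd heY heps hlam in
theorem transport_lie (u v : TauSpace p) :
    (transport π θ M ⁅u, v⁆ : TauSpace p') =
      ⁅(transport π θ M u : TauSpace p'), (transport π θ M v : TauSpace p')⁆ := by
  have hθ : ∀ α, ((θ (π α) : ℤ) : ℝ) * ((θ (π α) : ℤ) : ℝ) = 1 :=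
    fun α => unit_cast_mul_self (θ (π α))
  -- Cramer's rule solves `hlam` for `p'.lam`
  have hlam0 : ∀ α, p'.lam 0 (π α) = M.det * ((θ (π α) : ℤ) : ℝ) *
      (M 1 1 * p.lam 0 α - M 1 0 * p.lam 1 α) := by
    intro α
    rw [Matrix.det_fin_two] at *
    linear_combination (-(p'.lam 0 (π α))) * hd -
      (M 0 0 * M 1 1 - M 0 1 * M 1 0) * (M 1 1 * hlam 0 α - M 1 0 * hlam 1 α)
  have hlam1 : ∀ α, p'.lam 1 (π α) = M.det * ((θ (π α) : ℤ) : ℝ) *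
      (M 0 0 * p.lam 1 α - M 0 1 * p.lam 0 α) := by
    intro α
    rw [Matrix.det_fin_two] at *
    linear_combination (-(p'.lam 1 (π α))) * hd -
      (M 0 0 * M 1 1 - M 0 1 * M 1 0) * (M 0 0 * hlam 1 α - M 0 1 * hlam 0 α)
  apply ext_coeffs
  · simp only [transport_y, bracket_y, transport_Zs, Matrix.det_fin_two]
    ring
  · intro α
    obtain ⟨α, rfl⟩ := π.surjective α
    simp only [transport_Ws, bracket_Ws, transport_Zs, transport_W]
    linear_combination (-(u.Zs 0 * v.W α - v.Zs 0 * u.W α) * p.lam 0 α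
        - (u.Zs 1 * v.W α - v.Zs 1 * u.W α) * p.lam 1 α) * hθ α
      + ((θ (π α) : ℤ) : ℝ) * ((u.Zs 0 * v.W α - v.Zs 0 * u.W α) * hlam 0 α
        + (u.Zs 1 * v.W α - v.Zs 1 * u.W α) * hlam 1 α)
  · have hsum : ∑ α, p'.eps α * p'.lam 0 α * ((transport π θ M u : TauSpace p').Ws α
          * (transport π θ M v : TauSpace p').W α
          - (transport π θ M v : TauSpace p').Ws α * (transport π θ M u : TauSpace p').W α) =
        M.det * (M 1 1 * ∑ α, p.eps α * p.lam 0 α * (u.Ws α * v.W α - v.Ws α * u.W α)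
          - M 1 0 * ∑ α, p.eps α * p.lam 1 α * (u.Ws α * v.W α - v.Ws α * u.W α)) := by
      rw [← Equiv.sum_comp π, Finset.mul_sum, Finset.mul_sum, ← Finset.sum_sub_distrib,
        Finset.mul_sum]
      refine Finset.sum_congr rfl fun α _ => ?_
      rw [transport_Ws, transport_Ws, transport_W, transport_W, hlam0, heps]
      linear_combination M.det * p.eps α * (M 1 1 * p.lam 0 α - M 1 0 * p.lam 1 α) *
        (u.Ws α * v.W α - v.Ws α * u.W α) * hθ α
    rw [transport_Z_zero, bracket_Z_zero, bracket_Z_zero, bracket_Z_one, hsum, heY]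
    simp only [transport_y, transport_Zs]
    ring
  · have hsum : ∑ α, p'.eps α * p'.lam 1 α * ((transport π θ M u : TauSpace p').Ws α
          * (transport π θ M v : TauSpace p').W α
          - (transport π θ M v : TauSpace p').Ws α * (transport π θ M u : TauSpace p').W α) =
        M.det * (M 0 0 * ∑ α, p.eps α * p.lam 1 α * (u.Ws α * v.W α - v.Ws α * u.W α)
          - M 0 1 * ∑ α, p.eps α * p.lam 0 α * (u.Ws α * v.W α - v.Ws α * u.W α)) := by
      rw [← Equiv.sum_comp π, Finset.mul_sum, Finset.mul_sum, ← Finset.sum_sub_distrib,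
        Finset.mul_sum]
      refine Finset.sum_congr rfl fun α _ => ?_
      rw [transport_Ws, transport_Ws, transport_W, transport_W, hlam1, heps]
      linear_combination M.det * p.eps α * (M 0 0 * p.lam 1 α - M 0 1 * p.lam 0 α) *
        (u.Ws α * v.W α - v.Ws α * u.W α) * hθ α
    rw [transport_Z_one, bracket_Z_one, bracket_Z_one, bracket_Z_zero, hsum, heY]
    simp only [transport_y, transport_Zs]
    ring
  · intro α
    obtain ⟨α, rfl⟩ := π.surjective α
    simp only [transport_W, bracket_W, transport_Zs, transport_Ws, heps]
    linear_combination p.eps α * ((u.Ws α * v.Zs 0 - v.Ws α * u.Zs 0) * hlam 0 α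
      + (u.Ws α * v.Zs 1 - v.Ws α * u.Zs 1) * hlam 1 α)
  · simp [transport_Zs, bracket_Zs]
  · simp [transport_Zs, bracket_Zs]

include hd heY heps hlam in
theorem iso_of_transport : (tau p).Iso (tau p') := by
  have hinj : Function.Injective (transport π θ M : TauSpace p →ₗ[ℝ] TauSpace p') := by
    rw [injective_iff_map_eq_zero]
    intro u hu
    refine eq_zero_of_form u fun v => ?_
    rw [← transport_form hd heY heps u v, hu, map_zero, LinearMap.zero_apply]
  have hsurj := (LinearMap.injective_iff_surjective_of_finrank_eq_finrank finrank_eq).mp hinj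
  let F : TauSpace p →ₗ⁅ℝ⁆ TauSpace p' :=
    { (transport π θ M : TauSpace p →ₗ[ℝ] TauSpace p') with
      map_lie' := fun {u v} => transport_lie hd heY heps hlam u v }
  exact ⟨LieEquiv.ofBijective F ⟨hinj, hsurj⟩, transport_flip π θ M,
    fun u v => (transport_form hd heY heps u v).symm⟩

end transport

end TauSpace

/-! ### Rigidity of isomorphisms -/

/-- An invertible matrix has a non-vanishing term in the Leibniz expansion of its determinant. -/
theorem Matrix.exists_perm_forall_apply_ne_zero {ι R : Type*} [Fintype ι] [DecidableEq ι]
    [CommRing R] {U : Matrix ι ι R} (hU : U.det ≠ 0) :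
    ∃ π : Equiv.Perm ι, ∀ i, U (π i) i ≠ 0 := by
  by_contra! h
  refine hU ?_
  rw [Matrix.det_apply]
  refine Finset.sum_eq_zero fun π _ => ?_
  obtain ⟨i, hi⟩ := h π
  rw [Finset.prod_eq_zero (f := fun j => U (π j) j) (Finset.mem_univ i) hi, smul_zero]

theorem exists_unit_mul_eq {a b x y : ℝ} (hne : (a, b) ≠ (0, 0)) (h1 : a * a = x * x)
    (h2 : a * b = x * y) (h3 : b * b = y * y) : ∃ t : ℤˣ, ((t : ℤ) : ℝ) * a = x ∧
    ((t : ℤ) : ℝ) * b = y := by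
  by_cases ha : a = 0
  · have hb : b ≠ 0 := fun hb => hne (by rw [ha, hb])
    have hx : x = 0 := mul_self_eq_zero.mp (by rw [← h1, ha, mul_zero])
    rcases mul_self_eq_mul_self_iff.mp h3 with h | h
    · exact ⟨1, by simp [ha, hx], by simp [h]⟩
    · exact ⟨-1, by simp [ha, hx], by simp [h]⟩
  · rcases mul_self_eq_mul_self_iff.mp h1 with h | h
    · subst h
      exact ⟨1, by simp, by simpa using mul_left_cancel₀ ha h2⟩
    · refine ⟨-1, by simp [h], ?_⟩
      have : a * (-b) = a * y := by
        rw [h] at h2 ⊢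
        linear_combination -h2
      simpa using mul_left_cancel₀ ha this

namespace TauSpace

variable {s : ℕ} {p p' : TauParam s}

theorem lie_basisWs_lie_basisWs_Z (α : Fin s) (u : TauSpace p) (i : Fin 2) :
    ⁅(basisWs α : TauSpace p), ⁅(basisWs α : TauSpace p), u⁆⁆.Z i =
      -(p.lam i α * (p.lam 0 α * u.Zs 0 + p.lam 1 α * u.Zs 1)) := by
  have h : p.eps α * p.eps α = 1 := by unfold TauParam.eps; split_ifs <;> norm_num
  rw [lie_basisWs α u, lie_basisWs]
  simp only [Pi.single_eq_same]
  linear_combination (-(p.lam i α * (p.lam 0 α * u.Zs 0 + p.lam 1 α * u.Zs 1))) * h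

theorem lie_lie_basisW {a b : TauSpace p} (ha : flip a = a) (hb : flip b = b) (α : Fin s) :
    ⁅a, ⁅b, (basisW α : TauSpace p)⁆⁆ = 0 := by
  obtain ⟨haZ, haW, haZs⟩ := flip_eq_self ha
  obtain ⟨hbZ, hbW, hbZs⟩ := flip_eq_self hb
  apply ext_coeffs <;>
    simp [basisW, bracket_y, bracket_Ws, bracket_Z_zero, bracket_Z_one, bracket_W, bracket_Zs,
      haW, haZs, hbW, hbZs]

/-- On the vectors `x` without `Z^*`-coefficients, `x ↦ [[z, x], w]` acts diagonally on the
`W`-coefficients, with a form in `z, w` built from `ε_α` and `λ^α` as the `α`-th eigenvalue. -/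
theorem lie_lie_W {x : TauSpace p} (hx : x.Zs = 0) (z w : TauSpace p) (α : Fin s) :
    ⁅⁅z, x⁆, w⁆.W α = p.eps α * (p.lam 0 α * z.Zs 0 + p.lam 1 α * z.Zs 1) *
      (p.lam 0 α * w.Zs 0 + p.lam 1 α * w.Zs 1) * x.W α := by
  simp only [bracket_W ⁅z, x⁆, bracket_Ws, bracket_Zs, hx, Pi.zero_apply]
  ring

theorem lie_lie_basisZs (i j : Fin 2) (α : Fin s) :
    ⁅⁅(basisZs i : TauSpace p), (basisW α : TauSpace p)⁆, (basisZs j : TauSpace p)⁆ =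
      (p.eps α * p.lam i α * p.lam j α) • (basisW α : TauSpace p) := by
  apply ext_coeffs
  · simp [basisW, bracket_y, bracket_Zs, -lie_lie]
  · simp [basisW, basisZs, bracket_Ws, bracket_W, bracket_Zs, -lie_lie]
  · simp [basisW, basisZs, bracket_y, bracket_Z_zero, -lie_lie]
  · simp [basisW, basisZs, bracket_y, bracket_Z_one, -lie_lie]
  · intro β
    rw [lie_lie_W rfl]
    rcases eq_or_ne β α with rfl | h
    · fin_cases i <;> fin_cases j <;> simp [basisW, basisZs]
    · simp [basisW, Pi.single_eq_of_ne h]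
  · simp [basisW, bracket_Zs, -lie_lie]
  · simp [basisW, bracket_Zs, -lie_lie]

theorem lie_basisY_basisW (α : Fin s) : ⁅(basisY : TauSpace p), (basisW α : TauSpace p)⁆ = 0 := by
  rw [lie_basisY]
  apply ext_coeffs <;> simp [basisW]

theorem lie_basisZs : ⁅(basisZs 0 : TauSpace p), (basisZs 1 : TauSpace p)⁆ = basisY := by
  apply ext_coeffs <;>
    simp [basisZs, basisY, bracket_y, bracket_Ws, bracket_Z_zero, bracket_Z_one, bracket_W,
      bracket_Zs]

section rigidity

variable (Φ : TauSpace p ≃ₗ⁅ℝ⁆ TauSpace p') (hσ : ∀ u, Φ (flip u) = flip (Φ u))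
  (hB : ∀ u v, form u v = form (Φ u) (Φ v))

/-- The matrix of the map induced by `Φ` between the spans of the `Z_i^*`, modulo the other basis
vectors. -/
def zsMatrix : Matrix (Fin 2) (Fin 2) ℝ := Matrix.of fun i j => (Φ (basisZs j)).Zs i

/-- The matrix of the map induced by `Φ` between the spans of the `W_α`, modulo the other basis
vectors. -/
def wMatrix : Matrix (Fin s) (Fin s) ℝ := Matrix.of fun β α => (Φ (basisW α)).W β

include hσ

/-- Products of two elements of `𝔥` annihilate `W_α`, hence also its image, whereas
`[W_β^*, [W_β^*, x]] = 0` for all `β` forces the `Z^*`-coefficients of `x` to vanish when `λ₁, λ₂`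
are linearly independent. -/
theorem map_basisW_Zs (h : LinearIndependent ℝ p'.lam) (α : Fin s) : (Φ (basisW α)).Zs = 0 := by
  have hzero : ∀ β, p'.lam 0 β * (Φ (basisW α)).Zs 0 + p'.lam 1 β * (Φ (basisW α)).Zs 1 = 0 := by
    intro β
    obtain ⟨b, hb⟩ : ∃ b, Φ b = basisWs β := Φ.surjective (basisWs β)
    have hbf : flip b = b := Φ.injective ((hσ b).trans (by rw [hb, flip_basisWs]; exact hb.symm))
    have h0 : ⁅(basisWs β : TauSpace p'), ⁅(basisWs β : TauSpace p'), Φ (basisW α)⁆⁆ = 0 := by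
      rw [← hb, ← LieEquiv.map_lie, ← LieEquiv.map_lie, lie_lie_basisW hbf hbf, map_zero]
    by_contra hne
    have hlam : ∀ i, p'.lam i β = 0 := by
      intro i
      have := lie_basisWs_lie_basisWs_Z β (Φ (basisW α)) i
      rw [h0, zero_Z, Pi.zero_apply, eq_comm, neg_eq_zero] at this
      exact (mul_eq_zero.mp this).resolve_right hne
    exact p'.lam_ne β (by rw [hlam 0, hlam 1])
  have := Fintype.linearIndependent_iff.mp h (Φ (basisW α)).Zs (by
    ext β
    simp only [Fin.sum_univ_two, Pi.add_apply, Pi.smul_apply, smul_eq_mul, Pi.zero_apply]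
    linear_combination hzero β)
  exact funext this

theorem map_basisW_odd (α : Fin s) : (Φ (basisW α)).y = 0 ∧ (Φ (basisW α)).Ws = 0 :=
  eq_neg_flip (by rw [← hσ, flip_basisW, map_neg])

include hB in
theorem wMatrix_orthogonal (h : LinearIndependent ℝ p'.lam) :
    (wMatrix Φ).transpose * wMatrix Φ = 1 := by
  ext α β
  have := hB (basisW β) (basisW α)
  simp only [form_apply, map_basisW_Zs Φ hσ h, (map_basisW_odd Φ hσ _).1,
    (map_basisW_odd Φ hσ _).2] at this
  simp [basisW, Pi.single_apply] at this
  rw [Matrix.mul_apply, Matrix.one_apply]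
  rw [this]
  exact Finset.sum_congr rfl fun γ _ => mul_comm _ _

include hB in
theorem wMatrix_det_ne_zero (h : LinearIndependent ℝ p'.lam) : (wMatrix Φ).det ≠ 0 :=
  Matrix.det_ne_zero_of_left_inverse (wMatrix_orthogonal Φ hσ hB h)

/-- Comparison of `[[Z_i^*, W_α], Z_j^*]` with its image under `Φ`. -/
theorem wMatrix_ne_zero (h : LinearIndependent ℝ p'.lam) {β α : Fin s}
    (hne : wMatrix Φ β α ≠ 0) (i j : Fin 2) :
    p.eps α * p.lam i α * p.lam j α = p'.eps β *
      (p'.lam 0 β * zsMatrix Φ 0 i + p'.lam 1 β * zsMatrix Φ 1 i) *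
      (p'.lam 0 β * zsMatrix Φ 0 j + p'.lam 1 β * zsMatrix Φ 1 j) := by
  have h1 := congrArg (fun u => (Φ u).W β) (lie_lie_basisZs (p := p) i j α)
  simp only [LieEquiv.map_lie, lie_lie_W (map_basisW_Zs Φ hσ h α), map_smul, smul_W,
    Pi.smul_apply, smul_eq_mul] at h1
  exact (mul_right_cancel₀ hne h1).symm

include hB in
/-- `Φ` maps `y` to a multiple of `y`, since `[y, W_α] = 0` for all `α`. -/
theorem map_basisY_Ws (h : LinearIndependent ℝ p'.lam) : (Φ basisY).Ws = 0 := by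
  obtain ⟨-, -, hYZs⟩ := flip_eq_self (a := Φ basisY) (by rw [← hσ, flip_basisY])
  have hker : ∀ α i, ∑ β, p'.eps β * p'.lam i β * (Φ basisY).Ws β * wMatrix Φ β α = 0 := by
    intro α i
    have h0 : ⁅Φ basisY, Φ (basisW α)⁆ = 0 := by
      rw [← LieEquiv.map_lie, lie_basisY_basisW, map_zero]
    have hZ0 := bracket_Z_zero (Φ basisY) (Φ (basisW α))
    have hZ1 := bracket_Z_one (Φ basisY) (Φ (basisW α))
    simp only [h0, map_basisW_Zs Φ hσ h, (map_basisW_odd Φ hσ _).1, (map_basisW_odd Φ hσ _).2,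
      Pi.zero_apply, zero_Z, mul_zero, zero_mul, sub_zero, neg_zero, zero_sub] at hZ0 hZ1
    fin_cases i
    · simpa [wMatrix, mul_assoc] using hZ0.symm
    · simpa [wMatrix, mul_assoc] using hZ1.symm
  have hvec : ∀ i, (fun β => p'.eps β * p'.lam i β * (Φ basisY).Ws β) = 0 := fun i =>
    Matrix.eq_zero_of_vecMul_eq_zero (wMatrix_det_ne_zero Φ hσ hB h)
      (funext fun α => hker α i)
  funext β
  by_contra hne
  have hlam : ∀ i, p'.lam i β = 0 := by
    intro i
    have := congrFun (hvec i) β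
    have hne' : (Φ basisY).Ws β ≠ 0 := hne
    simpa [eps_ne_zero, hne'] using this
  exact p'.lam_ne β (by rw [hlam 0, hlam 1])

include hB in
theorem eY_eq_mul_det_sq (h : LinearIndependent ℝ p'.lam) :
    p.eY = p'.eY * (zsMatrix Φ).det ^ 2 := by
  obtain ⟨hYZ, hYW, hYZs⟩ := flip_eq_self (a := Φ basisY) (by rw [← hσ, flip_basisY])
  have hy : (Φ basisY).y = (zsMatrix Φ).det := by
    rw [← lie_basisZs, LieEquiv.map_lie, bracket_y, Matrix.det_fin_two]
    simp only [zsMatrix, Matrix.of_apply]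
    ring
  have := hB basisY basisY
  simp only [form_apply, map_basisY_Ws Φ hσ hB h, hYZ, hYW, hYZs, hy] at this
  simpa [basisY, sq] using this

end rigidity

end TauSpace

theorem TauParam.eY_injective {s : ℕ} {p p' : TauParam s} (h : p.eY = p'.eY) :
    p.epsY = p'.epsY := by
  unfold TauParam.eY at h
  exact Units.ext (by exact_mod_cast h)

open TauSpace in
/-- The comparison of `[[Z_i^*, W_α], Z_j^*]` on both sides determines `ε_α λ_i^α λ_j^α`, hence
`ε_α` and `(λ_1^α, λ_2^α)` up to sign, along any permutation that occurs in the Leibniz expansion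
of the determinant of the isometry induced between the spans of the `W_α`. -/
theorem exists_of_iso {s : ℕ} {p p' : TauParam s} (h' : LinearIndependent ℝ p'.lam)
    (hiso : (tau p).Iso (tau p')) :
    p.epsY = p'.epsY ∧ ∃ (π : Equiv.Perm (Fin s)) (θ : Fin s → ℤˣ)
      (M : Matrix (Fin 2) (Fin 2) ℝ), |M.det| = 1 ∧ (∀ α, p'.eps (π α) = p.eps α) ∧
      ∀ j α, ((θ (π α) : ℤ) : ℝ) * p.lam j α =
        M 0 j * p'.lam 0 (π α) + M 1 j * p'.lam 1 (π α) := by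
  obtain ⟨Φ, hσ, hB⟩ := hiso
  change TauSpace p ≃ₗ⁅ℝ⁆ TauSpace p' at Φ
  change ∀ u, Φ (flip u) = flip (Φ u) at hσ
  change ∀ u v, form u v = form (Φ u) (Φ v) at hB
  have heY := eY_eq_mul_det_sq Φ hσ hB h'
  obtain ⟨π, hπ⟩ := Matrix.exists_perm_forall_apply_ne_zero (wMatrix_det_ne_zero Φ hσ hB h')
  set M := zsMatrix Φ with hM
  have hsq : ∀ q : TauParam s, q.eY = 1 ∨ q.eY = -1 := fun q => by
    rcases Int.units_eq_one_or q.epsY with h | h <;> simp [TauParam.eY, h]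
  have hdet : p.eY = p'.eY ∧ M.det ^ 2 = 1 := by
    have := sq_nonneg M.det
    rcases hsq p with h | h <;> rcases hsq p' with h2 | h2 <;> rw [h, h2] at heY ⊢ <;>
      constructor <;> linarith
  have heps_or : ∀ (q : TauParam s) α, q.eps α = 1 ∨ q.eps α = -1 := fun q α => by
    unfold TauParam.eps; split_ifs <;> simp
  have key := fun α i j => wMatrix_ne_zero Φ hσ h' (hπ α) i j
  have heps : ∀ α, p'.eps (π α) = p.eps α := by
    intro α
    by_contra hne
    have hneg : p'.eps (π α) = -p.eps α := by
      rcases heps_or p α with h | h <;> rcases heps_or p' (π α) with h2 | h2 <;>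
        simp [h, h2] at hne ⊢
    have hzero : ∀ i, p.lam i α = 0 := by
      intro i
      have := key α i i
      rw [hneg, mul_assoc, mul_assoc, neg_mul, ← mul_neg] at this
      have := mul_left_cancel₀ (eps_ne_zero α) this
      refine mul_self_eq_zero.mp (le_antisymm ?_ (mul_self_nonneg _))
      rw [this]
      exact neg_nonpos.mpr (mul_self_nonneg _)
    exact p.lam_ne α (by rw [hzero 0, hzero 1])
  have hprod : ∀ α i j, p.lam i α * p.lam j α =
      (M 0 i * p'.lam 0 (π α) + M 1 i * p'.lam 1 (π α)) *
      (M 0 j * p'.lam 0 (π α) + M 1 j * p'.lam 1 (π α)) := by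
    intro α i j
    have := key α i j
    rw [heps, mul_assoc, mul_assoc] at this
    rw [mul_left_cancel₀ (eps_ne_zero α) this]
    ring
  choose t ht0 ht1 using fun α => exists_unit_mul_eq (p.lam_ne α) (hprod α 0 0) (hprod α 0 1)
    (hprod α 1 1)
  refine ⟨TauParam.eY_injective hdet.1, π, fun α => t (π.symm α), M, ?_, heps, fun j α => ?_⟩
  · rw [← abs_one (α := ℝ), ← sq_eq_sq_iff_abs_eq_abs, one_pow, hdet.2]
  · simp only [Equiv.symm_apply_apply]
    fin_cases j
    · exact ht0 α
    · exact ht1 α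

/-! ### Isomorphism classes and invariants -/

section Classification

variable {s : ℕ}

theorem iso_tau_iff_exists_signedPerm {p p' : TauParam s} (h' : LinearIndependent ℝ p'.lam) :
    (tau p).Iso (tau p') ↔ p.epsY = p'.epsY ∧ ∃ (π : Equiv.Perm (Fin s)) (θ : Fin s → ℤˣ),
      (∀ α, p'.eps (π α) = p.eps α) ∧ planeVolume p.lam = planeVolume p'.lam ∧
        (spanPlane p.lam).map (signedPerm π θ) = spanPlane p'.lam := by
  have hcomb : ∀ (π : Equiv.Perm (Fin s)) (θ : Fin s → ℤˣ) (M : Matrix (Fin 2) (Fin 2) ℝ),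
      (∀ i, signedPerm π θ (p.lam i) = ∑ j, M j i • p'.lam j) ↔
        ∀ j α, ((θ (π α) : ℤ) : ℝ) * p.lam j α =
          M 0 j * p'.lam 0 (π α) + M 1 j * p'.lam 1 (π α) := by
    intro π θ M
    refine forall_congr' fun i => ?_
    rw [funext_iff, ← π.forall_congr_right]
    simp [signedPerm, Fin.sum_univ_two]
  have hplane : ∀ (π : Equiv.Perm (Fin s)) (θ : Fin s → ℤˣ),
      (planeVolume p.lam = planeVolume p'.lam ∧
        (spanPlane p.lam).map (signedPerm π θ) = spanPlane p'.lam) ↔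
      ∃ M : Matrix (Fin 2) (Fin 2) ℝ, |M.det| = 1 ∧
        ∀ j α, ((θ (π α) : ℤ) : ℝ) * p.lam j α =
          M 0 j * p'.lam 0 (π α) + M 1 j * p'.lam 1 (π α) := by
    intro π θ
    rw [← spanPlane_signedPerm, ← planeVolume_signedPerm π θ p.lam, volume_and_span_eq_iff h']
    simp only [hcomb]
  simp only [hplane]
  constructor
  · intro hiso
    obtain ⟨heY, π, θ, M, hM, heps, hlam⟩ := exists_of_iso h' hiso
    exact ⟨heY, π, θ, heps, M, hM, hlam⟩
  · rintro ⟨heY, π, θ, heps, M, hM, hlam⟩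
    exact TauSpace.iso_of_transport (by rw [← sq_abs, hM, one_pow])
      (by simp only [TauParam.eY, heY]) heps hlam

/-- The point `P_λ` of the Grassmannian. -/
def TauParam.plane (p : TauParam s) (hp : LinearIndependent ℝ p.lam) : Plane s :=
  ⟨spanPlane p.lam, linearIndependent_iff_finrank_spanPlane.mp hp,
    not_spanPlane_subset_iff.mpr p.lam_ne⟩

/-- The tuple `(ε_Y, r, V_λ, [P_λ])`. -/
def TauParam.invariants (p : TauParam s) (hp : LinearIndependent ℝ p.lam) : Invariants s :=
  (p.epsY, ⟨p.r, ⟨planeVolume p.lam, planeVolume_pos hp⟩, Quotient.mk _ (p.plane hp)⟩)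

theorem invariants_mk_eq_iff {r r' : Fin (s + 1)} {V V' : Set.Ioi (0 : ℝ)} {P P' : Plane s} :
    (⟨r, V, Quotient.mk (planeSetoid s r) P⟩ :
        Σ r : Fin (s + 1), Set.Ioi (0 : ℝ) × Quotient (planeSetoid s r)) =
      ⟨r', V', Quotient.mk (planeSetoid s r') P'⟩ ↔
    ∃ (π : Equiv.Perm (Fin s)) (θ : Fin s → ℤˣ),
      (r = r' ∧ ∀ α, (π α : ℕ) < (r : ℕ) ↔ (α : ℕ) < (r : ℕ)) ∧ (V : ℝ) = V' ∧
        P.1.map (signedPerm π θ) = P'.1 := by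
  constructor
  · intro h
    obtain ⟨rfl, h⟩ := Sigma.mk.inj_iff.mp h
    obtain ⟨hV, hQ⟩ := Prod.mk.inj (eq_of_heq h)
    obtain ⟨π, θ, hπ, hP⟩ := Quotient.exact hQ
    exact ⟨π, θ, ⟨rfl, hπ⟩, congrArg Subtype.val hV, hP.symm⟩
  · rintro ⟨π, θ, ⟨rfl, hπ⟩, hV, hP⟩
    obtain rfl := Subtype.ext hV
    rw [Quotient.sound (s := planeSetoid s r) ⟨π, θ, hπ, hP.symm⟩]

theorem iso_tau_iff_invariants_eq {p p' : TauParam s} (h : LinearIndependent ℝ p.lam)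
    (h' : LinearIndependent ℝ p'.lam) :
    (tau p).Iso (tau p') ↔ p.invariants h = p'.invariants h' := by
  rw [iso_tau_iff_exists_signedPerm h', TauParam.invariants, TauParam.invariants, Prod.mk.injEq,
    invariants_mk_eq_iff]
  simp only [eps_perm_iff]
  rfl

theorem exists_invariants_eq (I : Invariants s) :
    ∃ (p : TauParam s) (hp : LinearIndependent ℝ p.lam), p.invariants hp = I := by
  obtain ⟨e, r, V, Q⟩ := I
  obtain ⟨P, rfl⟩ := Quotient.exists_rep Q
  obtain ⟨lam, hV, hP⟩ := exists_basis_of_volume P.2.1 V.2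
  have hli : LinearIndependent ℝ lam :=
    linearIndependent_iff_finrank_spanPlane.mpr (by rw [hP]; exact P.2.1)
  refine ⟨⟨e, r, lam, not_spanPlane_subset_iff.mp (by rw [hP]; exact P.2.2)⟩, hli, ?_⟩
  have h1 : (⟨planeVolume lam, planeVolume_pos hli⟩ : Set.Ioi (0 : ℝ)) = V := Subtype.ext hV
  have h2 : TauParam.plane ⟨e, r, lam, not_spanPlane_subset_iff.mp (by rw [hP]; exact P.2.2)⟩ hli
      = P := Subtype.ext hP
  rw [TauParam.invariants, h1, h2]

/-- The invariants of a triple, read off from a normal form of it. -/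
noncomputable def IndecTauRankTwo.invariants (T : IndecTauRankTwo s) : Invariants s :=
  T.2.2.choose.invariants T.2.2.choose_spec.1

theorem IndecTauRankTwo.invariants_eq {T : IndecTauRankTwo s} {p : TauParam s}
    (hp : LinearIndependent ℝ p.lam) (h : T.1.Iso (tau p)) : T.invariants = p.invariants hp :=
  (iso_tau_iff_invariants_eq T.2.2.choose_spec.1 hp).mp (T.2.2.choose_spec.2.symm.trans h)

theorem IndecTauRankTwo.iso_iff_invariants_eq (T T' : IndecTauRankTwo s) :
    T.1.Iso T'.1 ↔ T.invariants = T'.invariants := by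
  have h := T.2.2.choose_spec
  have h' := T'.2.2.choose_spec
  refine Iff.trans ⟨fun e => (h.2.symm.trans e).trans h'.2, fun e => (h.2.trans e).trans h'.2.symm⟩
    (iso_tau_iff_invariants_eq h.1 h'.1)

/-- The map induced by the invariants on isomorphism classes. -/
noncomputable def IsoClasses.invariants (c : IsoClasses s) : Invariants s :=
  Quotient.lift IndecTauRankTwo.invariants
    (fun T T' h => (IndecTauRankTwo.iso_iff_invariants_eq T T').mp h) c

theorem IsoClasses.invariants_isoClass (p : TauParam s) (hp : LinearIndependent ℝ p.lam)
    (hi : (tau p).Indecomposable) :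
    IsoClasses.invariants (isoClass p hp hi) = p.invariants hp :=
  IndecTauRankTwo.invariants_eq hp (.rfl _)

theorem IsoClasses.invariants_bijective :
    Function.Bijective (IsoClasses.invariants (s := s)) := by
  constructor
  · intro c c'
    refine Quotient.inductionOn₂ c c' fun T T' h => ?_
    exact Quotient.sound ((IndecTauRankTwo.iso_iff_invariants_eq T T').mpr h)
  · intro I
    obtain ⟨p, hp, rfl⟩ := exists_invariants_eq I
    exact ⟨isoClass p hp (indecomposable_tau p), invariants_isoClass p hp _⟩

end Classification

theorem mainTheorem3 (n : ℕ) (hn : 4 ≤ n) :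
    (∃ Φ : IsoClasses (n - 4) ≃ Invariants (n - 4),
      ∀ (p : TauParam (n - 4)) (hp : LinearIndependent ℝ p.lam) (hi : (tau p).Indecomposable),
        ∃ (V : Set.Ioi (0 : ℝ)) (P : Plane (n - 4)),
          (V : ℝ) = planeVolume p.lam ∧ P.1 = spanPlane p.lam ∧
          Φ (isoClass p hp hi) = (p.epsY, ⟨p.r, V, Quotient.mk (planeSetoid (n - 4) p.r) P⟩)) ∧
    (∀ (V : Set.Ioi (0 : ℝ)) (P : Plane (n - 4)), ∃ lam : Fin 2 → Fin (n - 4) → ℝ,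
      ∀ lam' : Fin 2 → Fin (n - 4) → ℝ,
        (planeVolume lam' = V ∧ spanPlane lam' = P.1) ↔
          ∃ S : Matrix (Fin 2) (Fin 2) ℝ, |S.det| = 1 ∧ ∀ i, lam' i = ∑ j, S j i • lam j) ∧
    (Nonempty (IsoClasses (n - 4)) → 5 < n) := by
  refine ⟨⟨Equiv.ofBijective _ IsoClasses.invariants_bijective, fun p hp hi =>
    ⟨⟨planeVolume p.lam, planeVolume_pos hp⟩, p.plane hp, rfl, rfl,
      IsoClasses.invariants_isoClass p hp hi⟩⟩, fun V P => ?_, ?_⟩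
  · obtain ⟨lam, hV, hP⟩ := exists_basis_of_volume P.2.1 V.2
    have hli : LinearIndependent ℝ lam :=
      linearIndependent_iff_finrank_spanPlane.mpr (by rw [hP]; exact P.2.1)
    exact ⟨lam, fun lam' => by rw [← volume_and_span_eq_iff hli, hV, hP]⟩
  · rintro ⟨c⟩
    obtain ⟨T, -⟩ := Quotient.exists_rep c
    obtain ⟨p, hp, -⟩ := T.2.2
    have := hp.fintype_card_le_finrank
    simp only [Fintype.card_fin, Module.finrank_fin_fun] at this
    omega
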